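/- Let $G$ be a finite undirected simple graph on $n$ vertices with edge weights $\mathrm{cost}\colon E(G)\to\mathbb{N}$. For a subgraph $F$ of $G$, let $\mathrm{cost}(F)$ be the sum of the weights of its edges. For a set $Z\subseteq V(G)$, let $\pi_F(Z)$ be the partition of $Z$ in which every $u\in Z\setminus V(F)$ forms a singleton class, and two vertices of $Z\cap V(F)$ lie in the same class if and only if they lie in the same connected component of $F$. For partitions $P,Q$ of $Z$, let $P\sqcup Q$ be their join, i.e. the finest partition of $Z$ of which both $P$ and $Q$ are refinements. For sets $\mathcal{R},\mathcal{B}$ of subgraphs of $G$, say that $\mathcal{R}$ represents $\mathcal{B}$ on $Z$ if for every partition $Q$ of $Z$ $$\min\{\mathrm{cost}(F): F\in\mathcal{B},\ \pi_F(Z)\sqcup Q=\{Z\}\}=\min\{\mathrm{cost}(F): F\in\mathcal{R},\ \pi_F(Z)\sqcup Q=\{Z\}\},$$ where $\min\emptyset=\infty$. There is an algorithm that, given such a weighted $n$-vertex graph $G$ and two disjoint sets $Y,Z\subseteq V(G)$ with $Z\neq\emptyset$, computes in time $2^{\mathcal{O}(|Z|)}\cdot\mathrm{poly}(n)$ (each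 addition, subtraction or comparison of natural numbers counting as one step) a set $\mathcal{R}$ of subgraphs of $G[Z\cup Y]$ such that 1. $|\mathcal{R}|\le 2^{|Z|-1}$, and 2. $\mathcal{R}$ represents the set $\mathcal{F}=\{F : F\subseteq G[Z\cup Y]\}$ of all subgraphs of $G[Z\cup Y]$ on $Z$. -/

import Mathlib

/-! ### Graphs, partitions and representation -/

namespace SteinerRep

/-- The set of all subgraphs of the induced subgraph `G[S]`. -/
def subgraphsOn {V : Type} (G : SimpleGraph V) (S : Set V) : Set G.Subgraph :=
  {F | F ≤ (⊤ : G.Subgraph).induce S}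

open Classical in
/-- The total weight of the edges of `F`. An edge weighting is a function on unordered pairs of
vertices, of which only the values at the edges of `G` matter. -/
noncomputable def cost {V : Type} [Fintype V] {G : SimpleGraph V} (w : Sym2 V → ℕ)
    (F : G.Subgraph) : ℕ :=
  ∑ e : Sym2 V with e ∈ F.edgeSet, w e

/-- The partition `π_F(Z)` of `Z`, as an equivalence relation on `Z`: vertices are equivalent when
they are joined by a walk in `F`; a vertex outside `F` is a class of its own
(see `connPartition_rel_iff`).

Partitions of `Z` are equivalence relations on `Z`. In Mathlib's lattice `Setoid Z` the join `⊔`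
is the finest partition coarser than both (the equivalence relation generated by the union), and
`⊤` is the partition `{Z}` when `Z` is nonempty. -/
def connPartition {V : Type} {G : SimpleGraph V} (F : G.Subgraph) (Z : Finset V) :
    Setoid {x // x ∈ Z} :=
  F.spanningCoe.reachableSetoid.comap Subtype.val

theorem connPartition_rel_iff {V : Type} {G : SimpleGraph V} (F : G.Subgraph) (Z : Finset V)
    (u v : {x // x ∈ Z}) :
    connPartition F Z u v ↔
      u = v ∨ ∃ (hu : u.1 ∈ F.verts) (hv : v.1 ∈ F.verts),
        F.coe.Reachable ⟨u.1, hu⟩ ⟨v.1, hv⟩ := by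
  have key : ∀ a b : V, F.spanningCoe.Reachable a b →
      a = b ∨ ∃ (ha : a ∈ F.verts) (hb : b ∈ F.verts), F.coe.Reachable ⟨a, ha⟩ ⟨b, hb⟩ := by
    rintro a b ⟨p⟩
    induction p with
    | nil => exact Or.inl rfl
    | @cons x y z hxy q ih =>
      have hF : F.Adj x y := hxy
      have hstep : F.coe.Reachable ⟨x, hF.fst_mem⟩ ⟨y, hF.snd_mem⟩ :=
        SimpleGraph.Adj.reachable (G := F.coe) hF
      rcases ih with rfl | ⟨hy, hz, h⟩
      · exact Or.inr ⟨_, _, hstep⟩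
      · exact Or.inr ⟨hF.fst_mem, hz, hstep.trans h⟩
  constructor
  · intro h
    rcases key u.1 v.1 h with h | h
    · exact Or.inl (Subtype.ext h)
    · exact Or.inr h
  · rintro (rfl | ⟨hu, hv, h⟩)
    · exact (connPartition F Z).refl u
    · exact h.map (⟨Subtype.val, fun h => h⟩ : F.coe →g F.spanningCoe)

/-- `R` represents `B` on `Z`: for every partition `Q` of `Z`, the minimum cost of an `F` with
`π_F(Z) ⊔ Q = {Z}` is the same over `F ∈ B` and over `F ∈ R`. The minimum of the empty set is
`∞`. -/
def Represents {V : Type} [Fintype V] {G : SimpleGraph V} (w : Sym2 V → ℕ) (Z : Finset V)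
    (R B : Set G.Subgraph) : Prop :=
  ∀ Q : Setoid {x // x ∈ Z},
    (⨅ F ∈ {F | F ∈ B ∧ connPartition F Z ⊔ Q = ⊤}, (cost w F : ℕ∞)) =
      ⨅ F ∈ {F | F ∈ R ∧ connPartition F Z ⊔ Q = ⊤}, (cost w F : ℕ∞)

/-! ### The machine model

A first-order while-language over binary trees whose leaves carry natural numbers, with unit cost.
The basic operations are: building a pair, taking a pair apart, testing whether a value is a pair,
and addition, truncated subtraction and comparison of numbers. Pairs are shared, not copied, and
programs have a fixed number of variables in scope at each point, so each unit of cost is a bounded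
number of steps of a random access machine with unit-cost addition. As there is no multiplication,
`t` steps produce numbers at most `2 ^ t` times the largest number in the input or program, and the
model is polynomially equivalent to Turing machines. -/

/-- The values that programs compute with. -/
inductive Val : Type
  | num : ℕ → Val
  | pair : Val → Val → Val

namespace Val

/-- First component; `0` on a number. -/
def fst : Val → Val
  | num _ => num 0
  | pair a _ => a

/-- Second component; `0` on a number. -/
def snd : Val → Val
  | num _ => num 0
  | pair _ b => b

/-- The number stored in a leaf; `0` on a pair. -/
def toNat : Val → ℕ
  | num n => n
  | pair _ _ => 0

/-- A truth value as a number, `1` or `0`. -/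
def ofBool (b : Bool) : Val := num (if b then 1 else 0)

/-- Whether the value is a pair. -/
def isPair : Val → Bool
  | num _ => false
  | pair _ _ => true

/-- A list as a chain of pairs that ends in `0`. -/
def ofList : List Val → Val
  | [] => num 0
  | a :: l => pair a (ofList l)

end Val

/-- Programs. Variables are de Bruijn indices into the list of values in scope. -/
inductive Prog : Type
  | var : ℕ → Prog
  | const : ℕ → Prog
  | pair : Prog → Prog → Prog
  | fst : Prog → Prog
  | snd : Prog → Prog
  | isPair : Prog → Prog
  | add : Prog → Prog → Prog
  | sub : Prog → Prog → Prog
  | le : Prog → Prog → Prog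
  /-- `ite c a b`: run `a` if `c` yields anything but the number `0`, and `b` otherwise. -/
  | ite : Prog → Prog → Prog → Prog
  /-- `letIn a b`: run `a`, then `b` with the result of `a` as the new variable `0`. -/
  | letIn : Prog → Prog → Prog
  /-- `loop c b`: while `c` does not yield the number `0`, replace the value of variable `0` by the
  result of `b`; the result is the final value of variable `0`. -/
  | loop : Prog → Prog → Prog

/-- `Run ρ e v t`: with the values `ρ` in scope, the program `e` halts with result `v` after exactly
`t` steps. Every executed construct costs one step. -/
inductive Run : List Val → Prog → Val → ℕ → Prop
  | var (ρ : List Val) (i : ℕ) : Run ρ (.var i) (ρ.getD i (.num 0)) 1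
  | const (ρ : List Val) (n : ℕ) : Run ρ (.const n) (.num n) 1
  | pair {ρ : List Val} {a b : Prog} {u v : Val} {s t : ℕ} :
      Run ρ a u s → Run ρ b v t → Run ρ (.pair a b) (.pair u v) (s + t + 1)
  | fst {ρ : List Val} {a : Prog} {u : Val} {s : ℕ} :
      Run ρ a u s → Run ρ (.fst a) u.fst (s + 1)
  | snd {ρ : List Val} {a : Prog} {u : Val} {s : ℕ} :
      Run ρ a u s → Run ρ (.snd a) u.snd (s + 1)
  | isPair {ρ : List Val} {a : Prog} {u : Val} {s : ℕ} :
      Run ρ a u s → Run ρ (.isPair a) (.ofBool u.isPair) (s + 1)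
  | add {ρ : List Val} {a b : Prog} {u v : Val} {s t : ℕ} :
      Run ρ a u s → Run ρ b v t → Run ρ (.add a b) (.num (u.toNat + v.toNat)) (s + t + 1)
  | sub {ρ : List Val} {a b : Prog} {u v : Val} {s t : ℕ} :
      Run ρ a u s → Run ρ b v t → Run ρ (.sub a b) (.num (u.toNat - v.toNat)) (s + t + 1)
  | le {ρ : List Val} {a b : Prog} {u v : Val} {s t : ℕ} :
      Run ρ a u s → Run ρ b v t →
        Run ρ (.le a b) (.ofBool (decide (u.toNat ≤ v.toNat))) (s + t + 1)
  | iteTrue {ρ : List Val} {c a b : Prog} {u v : Val} {s t : ℕ} :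
      Run ρ c u s → u ≠ .num 0 → Run ρ a v t → Run ρ (.ite c a b) v (s + t + 1)
  | iteFalse {ρ : List Val} {c a b : Prog} {v : Val} {s t : ℕ} :
      Run ρ c (.num 0) s → Run ρ b v t → Run ρ (.ite c a b) v (s + t + 1)
  | letIn {ρ : List Val} {a b : Prog} {u v : Val} {s t : ℕ} :
      Run ρ a u s → Run (u :: ρ) b v t → Run ρ (.letIn a b) v (s + t + 1)
  | loopDone {ρ : List Val} {c b : Prog} {x : Val} {s : ℕ} :
      Run (x :: ρ) c (.num 0) s → Run (x :: ρ) (.loop c b) x (s + 1)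
  | loopStep {ρ : List Val} {c b : Prog} {x y u v : Val} {s r t : ℕ} :
      Run (x :: ρ) c u s → u ≠ .num 0 → Run (x :: ρ) b y r → Run (y :: ρ) (.loop c b) v t →
        Run (x :: ρ) (.loop c b) v (s + r + t + 1)

/-- Programs are deterministic: the result and the number of steps are unique. -/
theorem Run.unique {ρ : List Val} {e : Prog} {v v' : Val} {t t' : ℕ} (h : Run ρ e v t)
    (h' : Run ρ e v' t') : v = v' ∧ t = t' := by
  induction h generalizing v' t' with
  | var | const => cases h'; exact ⟨rfl, rfl⟩
  | pair _ _ ih1 ih2 | add _ _ ih1 ih2 | sub _ _ ih1 ih2 | le _ _ ih1 ih2 | letIn _ _ ih1 ih2 =>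
    cases h'
    rename_i h1 h2
    obtain ⟨rfl, rfl⟩ := ih1 h1
    obtain ⟨rfl, rfl⟩ := ih2 h2
    exact ⟨rfl, rfl⟩
  | fst _ ih | snd _ ih | isPair _ ih =>
    cases h'
    rename_i h1
    obtain ⟨rfl, rfl⟩ := ih h1
    exact ⟨rfl, rfl⟩
  | iteTrue _ hu _ ih1 ih2 =>
    cases h' with
    | iteTrue h1 _ h2 =>
      obtain ⟨rfl, rfl⟩ := ih1 h1
      obtain ⟨rfl, rfl⟩ := ih2 h2
      exact ⟨rfl, rfl⟩
    | iteFalse h1 _ => exact absurd (ih1 h1).1 hu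
  | iteFalse _ _ ih1 ih2 =>
    cases h' with
    | iteTrue h1 hu _ => exact absurd (ih1 h1).1.symm hu
    | iteFalse h1 h2 =>
      obtain ⟨_, rfl⟩ := ih1 h1
      obtain ⟨rfl, rfl⟩ := ih2 h2
      exact ⟨rfl, rfl⟩
  | loopDone _ ih =>
    cases h' with
    | loopDone h1 => exact ⟨rfl, by rw [(ih h1).2]⟩
    | loopStep h1 hu _ _ => exact absurd (ih h1).1.symm hu
  | loopStep _ hu _ _ ih1 ih2 ih3 =>
    cases h' with
    | loopDone h1 => exact absurd (ih1 h1).1 hu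
    | loopStep h1 _ h2 h3 =>
      obtain ⟨rfl, rfl⟩ := ih1 h1
      obtain ⟨rfl, rfl⟩ := ih2 h2
      obtain ⟨rfl, rfl⟩ := ih3 h3
      exact ⟨rfl, rfl⟩

/-! ### Encodings of the input and the output -/

open Classical in
/-- A set of vertices as a list of `n` zeros and ones. -/
noncomputable def encodeSet {n : ℕ} (S : Set (Fin n)) : Val :=
  .ofList (List.ofFn fun i => .ofBool (decide (i ∈ S)))

open Classical in
/-- A weighted graph as the list of the rows of its weighted adjacency matrix: the entry of an edge
of weight `x` is `pair 0 x`, and the entry of a non-edge is the number `0`. -/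
noncomputable def encodeGraph {n : ℕ} (G : SimpleGraph (Fin n)) (w : Sym2 (Fin n) → ℕ) : Val :=
  .ofList (List.ofFn fun i => .ofList (List.ofFn fun j =>
    if G.Adj i j then .pair (.num 0) (.num (w s(i, j))) else .num 0))

/-- The input: the weighted graph and the two vertex sets. -/
noncomputable def encodeInput {n : ℕ} (G : SimpleGraph (Fin n)) (w : Sym2 (Fin n) → ℕ)
    (Y Z : Finset (Fin n)) : Val :=
  .pair (encodeGraph G w) (.pair (encodeSet (Y : Set (Fin n))) (encodeSet (Z : Set (Fin n))))

open Classical in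
/-- A subgraph as its vertex set together with the rows of its adjacency matrix. -/
noncomputable def encodeSubgraph {n : ℕ} {G : SimpleGraph (Fin n)} (F : G.Subgraph) : Val :=
  .pair (encodeSet F.verts) (.ofList (List.ofFn fun i => .ofList (List.ofFn fun j =>
    .ofBool (decide (F.Adj i j)))))

/-- The output: a list of subgraphs. -/
noncomputable def encodeFamily {n : ℕ} {G : SimpleGraph (Fin n)} (R : List G.Subgraph) : Val :=
  .ofList (R.map encodeSubgraph)

end SteinerRep

namespace SteinerRep

/-! ### A total expression language -/

namespace Val

/-! Fix `z₀ ∈ Z` and call the subsets of `Z` without `z₀` cuts. A cut respects a partition if it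
divides none of its classes. A partition with `c` classes respects `2 ^ (c - 1)` cuts, an odd number
only for `c = 1` (`sum_cuts_eq`), and a cut respects `P ⊔ Q` exactly when it respects both `P` and
`Q`. Hence, over the field with two elements, the truth value of `P ⊔ Q = ⊤` is the inner product of
the cut vectors of `P` and `Q` (`dot_cutsOf_eq_one_iff`), which have at most `2 ^ (|Z| - 1)`
coordinates. If the vector of `P` is a sum of vectors that cost no more, and its product with the
vector of `Q` is `1`, then so is the product for one of the summands. Gaussian elimination with
cheapest pivots therefore shrinks a family to one element per cut at most, without losing any
minimum (`Wp.reduce`).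

All subgraphs are too many to list, so they are assembled from connected pieces. A table holds, for
a set `X ⊆ Z` and a vertex `v`, a cheap graph that links `v` to all of `X`. It has at most `n * 2 ^
|Z|` entries and is filled by joining two entries along an edge (`Complete.succ`, `Wp.entries`).
Every subgraph is dominated by a sublist of the table with one entry per component that meets `Z`
(`exists_sublist`). The family then grows by one table entry at a time and is reduced after each one
(`Wp.family`). Recorded costs may exceed the true costs and recorded partitions may be finer than
the true ones; both errors are harmless.

For the running time, the algorithm is a fixed expression whose only loops are folds over lists. If
every fold has at most `m` iterations, the time is polynomial in `m` (`exists_bound_le`), and `m = n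
* 2 ^ |Z|` suffices. The predicate `Wp` carries correctness and the loop bounds together, and
`Wp.run` transfers both to the machine. -/

/-- Whether a value counts as true in a test. -/
def truth : Val → Bool
  | num 0 => false
  | _ => true

@[simp] theorem truth_ofBool (b : Bool) : (ofBool b).truth = b := by cases b <;> rfl

theorem truth_eq_false_iff {v : Val} : v.truth = false ↔ v = num 0 := by
  match v with
  | num 0 => simp [truth]
  | num (k + 1) => simp [truth]
  | pair _ _ => simp [truth]

/-- The number of iterations of a loop that consumes a list. -/
def len : Val → ℕ
  | num _ => 0
  | pair _ l => l.len + 1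

@[simp] theorem len_ofList (l : List Val) : (ofList l).len = l.length := by
  induction l with
  | nil => rfl
  | cons a l ih => simp [ofList, len, ih]

/-- The weakest precondition of a loop that consumes a list, where `W acc x` is the weakest
precondition of one iteration. -/
def foldWp (W : Val → Val → (Val → Prop) → Prop) : Val → Val → (Val → Prop) → Prop
  | num _, acc, Q => Q acc
  | pair x l, acc, Q => W acc x fun acc' => foldWp W l acc' Q

end Val

/-- Expressions whose only loops run over lists. Variables are de Bruijn indices. -/
inductive Expr : Type
  | var : ℕ → Expr
  | const : ℕ → Expr
  | pair : Expr → Expr → Expr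
  | fst : Expr → Expr
  | snd : Expr → Expr
  | isPair : Expr → Expr
  | add : Expr → Expr → Expr
  | le : Expr → Expr → Expr
  | ite : Expr → Expr → Expr → Expr
  | letIn : Expr → Expr → Expr
  /-- `lift e`: the value of `e` with the variable `0` removed from the scope. -/
  | lift : Expr → Expr
  /-- `fold l i b`: starting from the accumulator `i`, run through the list `l`, replacing the
  accumulator by `b` in the scope extended by the list element and the accumulator. -/
  | fold : Expr → Expr → Expr → Expr

namespace Expr

/-- Extends a renaming of variables under a binder. -/
def under (σ : ℕ → ℕ) : ℕ → ℕ
  | 0 => 0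
  | i + 1 => σ i + 1

/-- Extends a renaming of variables under the two binders of a loop. -/
def underFold (σ : ℕ → ℕ) : ℕ → ℕ
  | 0 => 0
  | 1 => 1
  -- The compiled loop body sees the accumulator, the list element and then the loop state
  -- (remaining list paired with accumulator). The state has no counterpart in the expression, hence
  -- the shift by three.
  | i + 2 => σ i + 3

/-- Translation of expressions to programs, along a renaming of the variables. -/
def compile : Expr → (ℕ → ℕ) → Prog
  | var i, σ => .var (σ i)
  | const n, _ => .const n
  | pair a b, σ => .pair (a.compile σ) (b.compile σ)
  | fst a, σ => .fst (a.compile σ)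
  | snd a, σ => .snd (a.compile σ)
  | isPair a, σ => .isPair (a.compile σ)
  | add a b, σ => .add (a.compile σ) (b.compile σ)
  | le a b, σ => .le (a.compile σ) (b.compile σ)
  | ite c a b, σ => .ite (c.compile σ) (a.compile σ) (b.compile σ)
  | letIn a b, σ => .letIn (a.compile σ) (b.compile (under σ))
  -- Lifting only shifts indices at compile time and costs no step. It lets an expression be used as
  -- a macro under binders.
  | lift a, σ => a.compile fun i => σ (i + 1)
  | fold l i b, σ =>
      .snd (.letIn (.pair (l.compile σ) (i.compile σ))
        (.loop (.isPair (.fst (.var 0)))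
          (.letIn (.fst (.fst (.var 0)))
            (.letIn (.snd (.var 1)) (.pair (.snd (.fst (.var 2))) (b.compile (underFold σ)))))))

/-- A bound on the running time when all loops have at most `m` iterations. -/
def bound : Expr → ℕ → ℕ
  | var _, _ => 1
  | const _, _ => 1
  | pair a b, m => a.bound m + b.bound m + 1
  | fst a, m => a.bound m + 1
  | snd a, m => a.bound m + 1
  | isPair a, m => a.bound m + 1
  | add a b, m => a.bound m + b.bound m + 1
  | le a b, m => a.bound m + b.bound m + 1
  | ite c a b, m => c.bound m + (a.bound m + b.bound m) + 1
  | letIn a b, m => a.bound m + b.bound m + 1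
  | lift a, m => a.bound m
  -- Testing, unpacking and repacking the state take exactly 15 steps per iteration. The final test
  -- and the surrounding constructs take 7, which 10 covers.
  | fold l i b, m => l.bound m + i.bound m + m * (b.bound m + 15) + 10

/-- The bound is built from constants by sums and by products with `m`, and domination by a monomial
is preserved by these operations. -/
theorem exists_bound_le (e : Expr) : ∃ C d : ℕ, ∀ m, 1 ≤ m → e.bound m ≤ C * m ^ d := by
  have hadd : ∀ f g : ℕ → ℕ, (∃ C d : ℕ, ∀ m, 1 ≤ m → f m ≤ C * m ^ d) →
      (∃ C d : ℕ, ∀ m, 1 ≤ m → g m ≤ C * m ^ d) →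
      ∃ C d : ℕ, ∀ m, 1 ≤ m → f m + g m ≤ C * m ^ d := by
    rintro f g ⟨C, d, hf⟩ ⟨C', d', hg⟩
    refine ⟨C + C', max d d', fun m hm => ?_⟩
    have h1 : m ^ d ≤ m ^ max d d' := Nat.pow_le_pow_right hm (le_max_left _ _)
    have h2 : m ^ d' ≤ m ^ max d d' := Nat.pow_le_pow_right hm (le_max_right _ _)
    calc f m + g m ≤ C * m ^ d + C' * m ^ d' := add_le_add (hf m hm) (hg m hm)
      _ ≤ C * m ^ max d d' + C' * m ^ max d d' := by gcongr
      _ = _ := by ring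
  have hconst : ∀ k : ℕ, ∃ C d : ℕ, ∀ m, 1 ≤ m → k ≤ C * m ^ d :=
    fun k => ⟨k, 0, fun m _ => by simp⟩
  have hmul : ∀ f : ℕ → ℕ, (∃ C d : ℕ, ∀ m, 1 ≤ m → f m ≤ C * m ^ d) →
      ∃ C d : ℕ, ∀ m, 1 ≤ m → m * f m ≤ C * m ^ d := by
    rintro f ⟨C, d, hf⟩
    refine ⟨C, d + 1, fun m hm => ?_⟩
    calc m * f m ≤ m * (C * m ^ d) := Nat.mul_le_mul_left _ (hf m hm)
      _ = _ := by ring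
  induction e with
  | var | const => exact hconst 1
  | pair a b ha hb | add a b ha hb | le a b ha hb | letIn a b ha hb =>
    exact hadd _ _ (hadd _ _ ha hb) (hconst 1)
  | fst a ha | snd a ha | isPair a ha => exact hadd _ _ ha (hconst 1)
  | ite c a b hc ha hb => exact hadd _ _ (hadd _ _ hc (hadd _ _ ha hb)) (hconst 1)
  | lift a ha => exact ha
  | fold l i b hl hi hb =>
    exact hadd _ _ (hadd _ _ (hadd _ _ hl hi) (hmul _ (hadd _ _ hb (hconst 15)))) (hconst 10)

/-- `Wp m e ρ Q`: in the scope `ρ`, the evaluation of `e` needs no loop with more than `m`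
iterations, and its result satisfies `Q`. -/
def Wp (m : ℕ) : Expr → List Val → (Val → Prop) → Prop
  | var i, ρ, Q => Q (ρ.getD i (.num 0))
  | const n, _, Q => Q (.num n)
  | pair a b, ρ, Q => a.Wp m ρ fun u => b.Wp m ρ fun v => Q (.pair u v)
  | fst a, ρ, Q => a.Wp m ρ fun u => Q u.fst
  | snd a, ρ, Q => a.Wp m ρ fun u => Q u.snd
  | isPair a, ρ, Q => a.Wp m ρ fun u => Q (.ofBool u.isPair)
  | add a b, ρ, Q => a.Wp m ρ fun u => b.Wp m ρ fun v => Q (.num (u.toNat + v.toNat))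
  | le a b, ρ, Q => a.Wp m ρ fun u => b.Wp m ρ fun v => Q (.ofBool (decide (u.toNat ≤ v.toNat)))
  | ite c a b, ρ, Q => c.Wp m ρ fun u => (u.truth = true → a.Wp m ρ Q) ∧ (u.truth = false → b.Wp m ρ Q)
  | letIn a b, ρ, Q => a.Wp m ρ fun u => b.Wp m (u :: ρ) Q
  | lift a, ρ, Q => a.Wp m ρ.tail Q
  | fold l i b, ρ, Q => l.Wp m ρ fun L => i.Wp m ρ fun acc =>
      L.len ≤ m ∧ L.foldWp (fun acc x Q' => b.Wp m (acc :: x :: ρ) Q') acc Q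

/-- Induction along the spine of the list. The hypothesis holds for every loop state `st` because
the body cannot read it. -/
theorem foldWp_run {W : Val → Val → (Val → Prop) → Prop} {b : Prog} {ρ : List Val} {B : ℕ}
    (h : ∀ st acc x Q, W acc x Q → ∃ v t, Run (acc :: x :: st :: ρ) b v t ∧ t ≤ B ∧ Q v)
    (L acc : Val) (Q : Val → Prop) (hw : L.foldWp W acc Q) :
    ∃ L' v t, Run (.pair L acc :: ρ)
      (.loop (.isPair (.fst (.var 0)))
          (.letIn (.fst (.fst (.var 0)))
            (.letIn (.snd (.var 1)) (.pair (.snd (.fst (.var 2))) b)))) (.pair L' v) t ∧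
      t ≤ L.len * (B + 15) + 4 ∧ Q v := by
  induction L generalizing acc with
  | num k =>
    exact ⟨_, acc, _, Run.loopDone (Run.isPair (Run.fst (Run.var _ 0))), by simp, hw⟩
  | pair x l _ ih =>
    obtain ⟨v, t, hr, ht, hv⟩ := h (.pair (.pair x l) acc) acc x _ hw
    obtain ⟨L', v', t', hr', ht', hv'⟩ := ih v hv
    refine ⟨L', v', _, Run.loopStep (Run.isPair (Run.fst (Run.var _ 0)))
      (by simp [Val.isPair, Val.ofBool, Val.fst])
      (Run.letIn (Run.fst (Run.fst (Run.var _ 0)))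
        (Run.letIn (Run.snd (Run.var _ 1)) (Run.pair (Run.snd (Run.fst (Run.var _ 2))) hr))) hr',
      ?_, hv'⟩
    simp only [Val.len]
    rw [Nat.add_mul]
    omega

/-- Expressions run within their time bound. -/
theorem Wp.run {m : ℕ} {e : Expr} {ρ ρ' : List Val} {σ : ℕ → ℕ} {Q : Val → Prop}
    (h : e.Wp m ρ Q) (hσ : ∀ i, ρ'.getD (σ i) (.num 0) = ρ.getD i (.num 0)) :
    ∃ v t, Run ρ' (e.compile σ) v t ∧ t ≤ e.bound m ∧ Q v := by
  induction e generalizing ρ ρ' σ Q with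
  | var i => exact ⟨_, 1, Run.var _ _, le_rfl, by rw [hσ]; exact h⟩
  | const n => exact ⟨_, 1, Run.const _ _, le_rfl, h⟩
  | pair a b iha ihb =>
    obtain ⟨u, s, hu, hs, hb⟩ := iha h hσ
    obtain ⟨v, t, hv, ht, hq⟩ := ihb hb hσ
    exact ⟨_, _, Run.pair hu hv, by simp only [bound]; omega, hq⟩
  | add a b iha ihb =>
    obtain ⟨u, s, hu, hs, hb⟩ := iha h hσ
    obtain ⟨v, t, hv, ht, hq⟩ := ihb hb hσ
    exact ⟨_, _, Run.add hu hv, by simp only [bound]; omega, hq⟩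
  | le a b iha ihb =>
    obtain ⟨u, s, hu, hs, hb⟩ := iha h hσ
    obtain ⟨v, t, hv, ht, hq⟩ := ihb hb hσ
    exact ⟨_, _, Run.le hu hv, by simp only [bound]; omega, hq⟩
  | fst a iha =>
    obtain ⟨u, s, hu, hs, hb⟩ := iha h hσ
    exact ⟨_, _, Run.fst hu, by simp only [bound]; omega, hb⟩
  | snd a iha =>
    obtain ⟨u, s, hu, hs, hb⟩ := iha h hσ
    exact ⟨_, _, Run.snd hu, by simp only [bound]; omega, hb⟩
  | isPair a iha =>
    obtain ⟨u, s, hu, hs, hb⟩ := iha h hσ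
    exact ⟨_, _, Run.isPair hu, by simp only [bound]; omega, hb⟩
  | ite c a b ihc iha ihb =>
    obtain ⟨u, s, hu, hs, h1, h2⟩ := ihc h hσ
    by_cases hc : u.truth = true
    · obtain ⟨v, t, hv, ht, hq⟩ := iha (h1 hc) hσ
      refine ⟨_, _, Run.iteTrue hu ?_ hv, by simp only [bound]; omega, hq⟩
      rintro rfl
      simp [Val.truth] at hc
    · rw [Bool.not_eq_true] at hc
      obtain ⟨v, t, hv, ht, hq⟩ := ihb (h2 hc) hσ
      rw [Val.truth_eq_false_iff.1 hc] at hu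
      exact ⟨_, _, Run.iteFalse hu hv, by simp only [bound]; omega, hq⟩
  | letIn a b iha ihb =>
    obtain ⟨u, s, hu, hs, hb⟩ := iha h hσ
    obtain ⟨v, t, hv, ht, hq⟩ := ihb (ρ' := u :: ρ') (σ := under σ) hb (by
      rintro (_ | i)
      · rfl
      · simpa [under] using hσ i)
    exact ⟨_, _, Run.letIn hu hv, by simp only [bound]; omega, hq⟩
  | lift a iha =>
    refine iha (σ := fun i => σ (i + 1)) h fun i => ?_
    rw [hσ]
    cases ρ <;> simp
  | fold l i b ihl ihi ihb =>
    obtain ⟨L, s, hL, hs, hi⟩ := ihl h hσ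
    obtain ⟨acc, t, hacc, ht, hlen, hw⟩ := ihi hi hσ
    obtain ⟨L', v, r, hr, hrt, hq⟩ := foldWp_run (ρ := ρ') (b := b.compile (underFold σ))
      (B := b.bound m) (fun st acc x Q' hw' => ihb hw' (by
        rintro (_ | _ | i)
        · rfl
        · rfl
        · simpa [underFold] using hσ i)) L acc Q hw
    refine ⟨v, _, Run.snd (Run.letIn (Run.pair hL hacc) hr), ?_, hq⟩
    have : L.len * (b.bound m + 15) ≤ m * (b.bound m + 15) := Nat.mul_le_mul_right _ hlen
    simp only [bound]
    omega

/-! ### Proof rules for the evaluation of expressions -/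

theorem foldWp_mono {W W' : Val → Val → (Val → Prop) → Prop}
    (h : ∀ acc x Q Q', (∀ v, Q v → Q' v) → W acc x Q → W' acc x Q') {L acc : Val}
    {Q Q' : Val → Prop} (hQ : ∀ v, Q v → Q' v) (hw : L.foldWp W acc Q) : L.foldWp W' acc Q' := by
  induction L generalizing acc with
  | num k => exact hQ _ hw
  | pair x l _ ih => exact h _ _ _ _ (fun v hv => ih hv) hw

theorem Wp.mono {m : ℕ} {e : Expr} {ρ : List Val} {Q Q' : Val → Prop}
    (h : e.Wp m ρ Q) (hQ : ∀ v, Q v → Q' v) : e.Wp m ρ Q' := by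
  induction e generalizing ρ Q Q' with
  | var | const => exact hQ _ h
  | pair a b iha ihb | add a b iha ihb | le a b iha ihb =>
    exact iha h fun u hu => ihb hu fun v hv => hQ _ hv
  | fst a iha | snd a iha | isPair a iha => exact iha h fun u hu => hQ _ hu
  | ite c a b ihc iha ihb =>
    exact ihc h fun u hu => ⟨fun h1 => iha (hu.1 h1) hQ, fun h2 => ihb (hu.2 h2) hQ⟩
  | letIn a b iha ihb => exact iha h fun u hu => ihb hu hQ
  | lift a iha => exact iha h hQ
  | fold l i b ihl ihi ihb =>
    exact ihl h fun L hL => ihi hL fun acc hacc =>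
      ⟨hacc.1, foldWp_mono (W := fun acc x Q' => b.Wp m (acc :: x :: ρ) Q')
        (fun acc x Q Q' hQ h => ihb h hQ) hQ hacc.2⟩

/-- `e` evaluates to `v`, by loops of at most `m` iterations. -/
def Ev (m : ℕ) (e : Expr) (ρ : List Val) (v : Val) : Prop :=
  ∀ Q : Val → Prop, Q v → e.Wp m ρ Q

/-- `Ev` ranges over all postconditions so that evaluations compose by mere application; to
establish it, the single postcondition `· = v` is enough. -/
theorem Wp.ev {m : ℕ} {e : Expr} {ρ : List Val} {v : Val} (h : e.Wp m ρ (· = v)) : e.Ev m ρ v :=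
  fun _ hQ => h.mono fun _ hu => hu ▸ hQ

/-- The loop rule: `I` is an invariant of the part of the list that has been run through and the
accumulator. -/
theorem Wp.fold {α : Type*} {m : ℕ} {l i b : Expr} {ρ : List Val} {Q : Val → Prop}
    {xs : List α} {enc : α → Val} {v₀ : Val} (I : List α → Val → Prop)
    (hl : l.Ev m ρ (.ofList (xs.map enc))) (hi : i.Ev m ρ v₀) (hm : xs.length ≤ m)
    (h0 : I [] v₀)
    (hs : ∀ pre x post, xs = pre ++ x :: post → ∀ acc, I pre acc →
      b.Wp m (acc :: enc x :: ρ) (I (pre ++ [x])))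
    (hQ : ∀ v, I xs v → Q v) : (Expr.fold l i b).Wp m ρ Q := by
  refine hl _ (hi _ ⟨by simpa using hm, ?_⟩)
  suffices H : ∀ (post pre : List α) (acc : Val), xs = pre ++ post → I pre acc →
      (Val.ofList (post.map enc)).foldWp (fun acc x Q' => b.Wp m (acc :: x :: ρ) Q') acc Q from
    H xs [] v₀ rfl h0
  intro post
  induction post with
  | nil =>
    intro pre acc hx hI
    rw [List.append_nil] at hx
    exact hQ _ (hx ▸ hI)
  | cons x post ih =>
    intro pre acc hx hI
    exact (hs pre x post hx acc hI).mono fun v hv => ih (pre ++ [x]) v (by simp [hx]) hv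

/-- The loop rule for a loop that computes a known function. -/
theorem Ev.fold {α β : Type*} {m : ℕ} {l i b : Expr} {ρ : List Val} {xs : List α}
    {enc : α → Val} {enc' : β → Val} {b₀ : β} (f : β → α → β)
    (hl : l.Ev m ρ (.ofList (xs.map enc))) (hi : i.Ev m ρ (enc' b₀)) (hm : xs.length ≤ m)
    (hs : ∀ x ∈ xs, ∀ acc, b.Ev m (enc' acc :: enc x :: ρ) (enc' (f acc x))) :
    (Expr.fold l i b).Ev m ρ (enc' (xs.foldl f b₀)) :=
  Wp.ev <| Wp.fold (fun pre v => v = enc' (pre.foldl f b₀)) hl hi hm rfl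
    (by
      rintro pre x post rfl acc rfl
      exact hs x (by simp) _ _ (by simp)) fun v hv => hv

theorem Ev.var {m i : ℕ} {ρ : List Val} {v : Val} (h : ρ.getD i (.num 0) = v) :
    (Expr.var i).Ev m ρ v := fun _ hQ => by subst h; exact hQ

theorem Ev.const {m k : ℕ} {ρ : List Val} : (Expr.const k).Ev m ρ (.num k) := fun _ hQ => hQ

theorem Ev.pair {m : ℕ} {a b : Expr} {ρ : List Val} {u v : Val} (ha : a.Ev m ρ u)
    (hb : b.Ev m ρ v) : (Expr.pair a b).Ev m ρ (.pair u v) := fun _ hQ => ha _ (hb _ hQ)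

theorem Ev.fst {m : ℕ} {a : Expr} {ρ : List Val} {u v : Val} (ha : a.Ev m ρ (.pair u v)) :
    (Expr.fst a).Ev m ρ u := fun _ hQ => ha _ hQ

theorem Ev.snd {m : ℕ} {a : Expr} {ρ : List Val} {u v : Val} (ha : a.Ev m ρ (.pair u v)) :
    (Expr.snd a).Ev m ρ v := fun _ hQ => ha _ hQ

theorem Ev.lift {m : ℕ} {a : Expr} {ρ : List Val} {u v : Val} (ha : a.Ev m ρ v) :
    (Expr.lift a).Ev m (u :: ρ) v := ha

theorem Ev.letIn {m : ℕ} {a b : Expr} {ρ : List Val} {u v : Val} (ha : a.Ev m ρ u)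
    (hb : b.Ev m (u :: ρ) v) : (Expr.letIn a b).Ev m ρ v := fun _ hQ => ha _ (hb _ hQ)

theorem Ev.add {m : ℕ} {a b : Expr} {ρ : List Val} {x y : ℕ} (ha : a.Ev m ρ (.num x))
    (hb : b.Ev m ρ (.num y)) : (Expr.add a b).Ev m ρ (.num (x + y)) := fun _ hQ => ha _ (hb _ hQ)

open Classical in
/-- The truth value of a proposition. -/
noncomputable def tv (p : Prop) : Val := .ofBool (decide p)

theorem tv_true {p : Prop} (h : p) : tv p = .num 1 := by simp [tv, h, Val.ofBool]

theorem tv_false {p : Prop} (h : ¬p) : tv p = .num 0 := by simp [tv, h, Val.ofBool]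

theorem Ev.le {m : ℕ} {a b : Expr} {ρ : List Val} {x y : ℕ} (ha : a.Ev m ρ (.num x))
    (hb : b.Ev m ρ (.num y)) : (Expr.le a b).Ev m ρ (tv (x ≤ y)) := fun _ hQ =>
  ha _ (hb _ (by unfold tv at hQ; convert hQ <;> rfl))

theorem Ev.isPair {m : ℕ} {a : Expr} {ρ : List Val} {v : Val} (ha : a.Ev m ρ v) :
    (Expr.isPair a).Ev m ρ (tv (v.isPair = true)) := fun _ hQ => ha _ (by simpa [tv] using hQ)

/-- Tests are evaluated by cases. -/
theorem Ev.iteWp {m : ℕ} {c a b : Expr} {ρ : List Val} {p : Prop} {Q : Val → Prop}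
    (hc : c.Ev m ρ (tv p)) (ha : p → a.Wp m ρ Q) (hb : ¬p → b.Wp m ρ Q) :
    (Expr.ite c a b).Wp m ρ Q :=
  hc _ ⟨fun h => ha (by simpa [tv] using h), fun h => hb (by simpa [tv] using h)⟩

theorem Ev.iteTrue {m : ℕ} {c a b : Expr} {ρ : List Val} {p : Prop} {v : Val}
    (hc : c.Ev m ρ (tv p)) (hp : p) (ha : a.Ev m ρ v) : (Expr.ite c a b).Ev m ρ v :=
  fun _ hQ => hc.iteWp (fun _ => ha _ hQ) fun h => absurd hp h

theorem Ev.iteFalse {m : ℕ} {c a b : Expr} {ρ : List Val} {p : Prop} {v : Val}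
    (hc : c.Ev m ρ (tv p)) (hp : ¬p) (hb : b.Ev m ρ v) : (Expr.ite c a b).Ev m ρ v :=
  fun _ hQ => hc.iteWp (fun h => absurd h hp) fun _ => hb _ hQ

/-- Negation. -/
def not (a : Expr) : Expr := ite a (const 0) (const 1)

/-- Conjunction. -/
def and (a b : Expr) : Expr := ite a b (const 0)

/-- Disjunction. -/
def or (a b : Expr) : Expr := ite a (const 1) b

/-- Implication. -/
def imp (a b : Expr) : Expr := ite a b (const 1)

/-- Equivalence. -/
def iff (a b : Expr) : Expr := ite a b (not b)

/-- Equality of numbers. -/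
def eq (a b : Expr) : Expr := and (le a b) (le b a)

section
variable {m : ℕ} {a b : Expr} {ρ : List Val} {p q : Prop}

theorem Ev.not (ha : a.Ev m ρ (tv p)) : (Expr.not a).Ev m ρ (tv ¬p) := by
  by_cases hp : p
  · rw [tv_false (not_not.2 hp)]; exact ha.iteTrue hp Ev.const
  · rw [tv_true hp]; exact ha.iteFalse hp Ev.const

/-- Evaluation short-circuits, so the second operand need only make sense when the first one holds.
-/
theorem Ev.and (ha : a.Ev m ρ (tv p)) (hb : p → b.Ev m ρ (tv q)) :
    (Expr.and a b).Ev m ρ (tv (p ∧ q)) := by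
  by_cases hp : p
  · rw [show (p ∧ q) = q by simp [hp]]; exact ha.iteTrue hp (hb hp)
  · rw [tv_false (by simp [hp])]; exact ha.iteFalse hp Ev.const

theorem Ev.or (ha : a.Ev m ρ (tv p)) (hb : ¬p → b.Ev m ρ (tv q)) :
    (Expr.or a b).Ev m ρ (tv (p ∨ q)) := by
  by_cases hp : p
  · rw [tv_true (Or.inl hp)]; exact ha.iteTrue hp Ev.const
  · rw [show (p ∨ q) = q by simp [hp]]; exact ha.iteFalse hp (hb hp)

theorem Ev.imp (ha : a.Ev m ρ (tv p)) (hb : b.Ev m ρ (tv q)) :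
    (Expr.imp a b).Ev m ρ (tv (p → q)) := by
  by_cases hp : p
  · rw [show (p → q) = q by simp [hp]]; exact ha.iteTrue hp hb
  · rw [tv_true (fun h => absurd h hp)]; exact ha.iteFalse hp Ev.const

theorem Ev.iff (ha : a.Ev m ρ (tv p)) (hb : b.Ev m ρ (tv q)) :
    (Expr.iff a b).Ev m ρ (tv (p ↔ q)) := by
  by_cases hp : p
  · rw [show (p ↔ q) = q by simp [hp]]; exact ha.iteTrue hp hb
  · rw [show (p ↔ q) = ¬q by simp [hp]]; exact ha.iteFalse hp hb.not

theorem Ev.eq {x y : ℕ} (ha : a.Ev m ρ (.num x)) (hb : b.Ev m ρ (.num y)) :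
    (Expr.eq a b).Ev m ρ (tv (x = y)) := by
  rw [show (x = y) = (x ≤ y ∧ y ≤ x) from propext le_antisymm_iff]
  exact (ha.le hb).and fun _ => hb.le ha

end

/-! ### Tables indexed by `Fin n` -/

/-- The list of the numbers below `n` in decreasing order. -/
def downto (n : ℕ) : Val := .ofList ((List.range n).reverse.map .num)

/-- The table of the values of a function. -/
def table {n : ℕ} (f : Fin n → Val) : Val := .ofList (List.ofFn f)

/-- The numbers below the length of a list, in decreasing order. -/
def range (l : Expr) : Expr :=
  fold l (const 0) (pair (ite (isPair (var 0)) (add (fst (var 0)) (const 1)) (const 0)) (var 0))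

theorem downto_succ (n : ℕ) : downto (n + 1) = .pair (.num n) (downto n) := by
  simp [downto, List.range_succ, Val.ofList]

theorem downto_eq (n : ℕ) :
    downto n = .ofList ((List.finRange n).reverse.map fun i : Fin n => .num i) := by
  rw [downto, ← List.map_coe_finRange_eq_range, ← List.map_reverse, List.map_map]
  rfl

/-- After `k` elements the accumulator is `downto k`, whose head is `k - 1`; adding one to the head
gives the next number, and the empty accumulator gives `0`. -/
theorem Ev.range {α : Type*} {m : ℕ} {l : Expr} {ρ : List Val} {xs : List α} {enc : α → Val}
    (hl : l.Ev m ρ (.ofList (xs.map enc))) (hm : xs.length ≤ m) :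
    (Expr.range l).Ev m ρ (downto xs.length) := by
  refine Wp.ev (Wp.fold (fun pre v => v = downto pre.length) hl Ev.const hm rfl ?_ fun v hv => hv)
  rintro pre x post - acc rfl
  have key : (Expr.ite (.isPair (.var 0)) (.add (.fst (.var 0)) (.const 1)) (.const 0)).Ev m
      (downto pre.length :: enc x :: ρ) (.num pre.length) := by
    cases h : pre.length with
    | zero =>
      exact Ev.iteFalse (Ev.isPair (Ev.var (v := downto 0) rfl))
        (by simp [downto, Val.ofList, Val.isPair]) Ev.const
    | succ k =>
      rw [downto_succ]
      exact Ev.iteTrue (Ev.isPair (Ev.var rfl)) rfl (Ev.add (Ev.fst (Ev.var rfl)) Ev.const)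
  refine (key.pair (Ev.var rfl)) _ ?_
  simp [downto_succ]

/-- The table of the values of `f`, in the scope extended by the index, for the indices in `a`. -/
def tab (a f : Expr) : Expr := fold a (const 0) (pair (lift f) (var 0))

/-- The fold prepends each value, so a decreasing list of indices yields a table in increasing
order. -/
theorem Ev.tab {m n : ℕ} {a f : Expr} {ρ : List Val} {g : Fin n → Val}
    (ha : a.Ev m ρ (downto n)) (hf : ∀ i : Fin n, f.Ev m (.num i :: ρ) (g i)) (hm : n ≤ m) :
    (Expr.tab a f).Ev m ρ (table g) := by
  rw [downto_eq] at ha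
  have := Ev.fold (enc' := Val.ofList) (b₀ := []) (fun acc i => g i :: acc) ha
    (Ev.const (k := 0)) (by simpa using hm) (b := .pair (.lift f) (.var 0)) (fun i _ acc =>
      Ev.pair (Ev.lift (hf i)) (Ev.var rfl))
  rw [List.foldl_reverse] at this
  have h2 : ∀ l : List (Fin n), l.foldr (fun x y => g x :: y) [] = l.map g := fun l => by
    induction l <;> simp_all
  rw [h2, ← List.ofFn_eq_map] at this
  exact this

/-- The entry at position `c` of the table `b` of length `n`, where `a` is the list of the numbers
below `n`. -/
def nth (a b c : Expr) : Expr :=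
  fst (fold a b (ite (le (lift (lift c)) (var 1)) (var 0) (snd (var 0))))

theorem iterate_snd_ofList (L : List Val) (i : ℕ) :
    Val.snd^[i] (.ofList L) = .ofList (L.drop i) := by
  induction i generalizing L with
  | zero => rfl
  | succ i ih =>
    rw [Function.iterate_succ_apply]
    cases L with
    | nil => simpa [Val.ofList, Val.snd] using ih []
    | cons x L => simpa [Val.ofList, Val.snd] using ih L

/-- No counter is needed: the fold over the indices below `n` drops one head for each index `x < i`,
that is, `i` times. -/
theorem Ev.nth {m n : ℕ} {a b c : Expr} {ρ : List Val} {f : Fin n → Val} {i : Fin n}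
    (ha : a.Ev m ρ (downto n)) (hb : b.Ev m ρ (table f)) (hc : c.Ev m ρ (.num i)) (hm : n ≤ m) :
    (Expr.nth a b c).Ev m ρ (f i) := by
  have hfold := Ev.fold (enc' := id) (fun acc (x : ℕ) => if (i : ℕ) ≤ x then acc else acc.snd) ha hb
    (by simpa using hm) (b := .ite (.le (.lift (.lift c)) (.var 1)) (.var 0) (.snd (.var 0)))
    (fun x _ acc => by
      by_cases h : (i : ℕ) ≤ x
      · rw [if_pos h]
        exact Ev.iteTrue (Ev.le (Ev.lift (Ev.lift hc)) (Ev.var rfl)) h (Ev.var rfl)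
      · rw [if_neg h]
        refine Ev.iteFalse (Ev.le (Ev.lift (Ev.lift hc)) (Ev.var rfl)) h fun Q hQ => hQ)
  have key : ∀ k v, ((List.range k).reverse.foldl (fun acc (x : ℕ) =>
      if (i : ℕ) ≤ x then acc else acc.snd) v) = Val.snd^[min k i] v := by
    intro k
    induction k with
    | zero => intro v; simp
    | succ k ih =>
      intro v
      rw [List.range_succ, List.reverse_append]
      simp only [List.reverse_singleton, List.singleton_append, List.foldl_cons]
      rw [ih]
      split_ifs with h
      · rw [min_eq_right h, min_eq_right (h.trans k.le_succ)]
      · rw [min_eq_left (by omega), min_eq_left (by omega), Function.iterate_succ_apply]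
  rw [key, min_eq_right i.2.le, id, iterate_snd_ofList,
    List.drop_eq_getElem_cons (by simp)] at hfold
  simpa [Expr.nth] using hfold.fst

/-- Whether `f` holds, in the scope extended by the index, for all indices in `a`. -/
def all (a f : Expr) : Expr := fold a (const 1) (and (var 0) (lift f))

theorem Ev.all {m n : ℕ} {a f : Expr} {ρ : List Val} {p : Fin n → Prop}
    (ha : a.Ev m ρ (downto n)) (hf : ∀ i : Fin n, f.Ev m (.num i :: ρ) (tv (p i))) (hm : n ≤ m) :
    (Expr.all a f).Ev m ρ (tv (∀ i, p i)) := by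
  rw [downto_eq] at ha
  refine Wp.ev (Wp.fold (fun pre v => v = tv (∀ i ∈ pre, p i)) ha Ev.const (by simpa using hm)
    (tv_true (by simp)).symm ?_ fun v hv => by simpa using hv)
  rintro pre x post - acc rfl
  refine Ev.and (Ev.var rfl) (fun _ => Ev.lift (hf x)) _ ?_
  congr 1
  simp [or_imp, forall_and]

end Expr

end SteinerRep

namespace SteinerRep

/-! ### Sets and graphs as tables -/

/-- The adjacency matrix of a graph. -/
noncomputable def encodeAdj {n : ℕ} (H : SimpleGraph (Fin n)) : Val :=
  Expr.table fun i => Expr.table fun j => Expr.tv (H.Adj i j)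

namespace Expr

/-- Membership of `c` in the set `b`, where `a` lists the indices. -/
def mem (a b c : Expr) : Expr := nth a b c

/-- The union of two sets. -/
def union (a b c : Expr) : Expr :=
  tab a (or (mem (lift a) (lift b) (var 0)) (mem (lift a) (lift c) (var 0)))

/-- The intersection of two sets. -/
def inter (a b c : Expr) : Expr :=
  tab a (and (mem (lift a) (lift b) (var 0)) (mem (lift a) (lift c) (var 0)))

/-- The symmetric difference of two sets. -/
def symmDiff (a b c : Expr) : Expr :=
  tab a (not (iff (mem (lift a) (lift b) (var 0)) (mem (lift a) (lift c) (var 0))))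

/-- Equality of sets. -/
def setEq (a b c : Expr) : Expr :=
  all a (iff (mem (lift a) (lift b) (var 0)) (mem (lift a) (lift c) (var 0)))

/-- Whether the set `b` does not cross the cut `c`. -/
def uncut (a b c : Expr) : Expr :=
  or (all a (imp (mem (lift a) (lift b) (var 0)) (mem (lift a) (lift c) (var 0))))
    (all a (imp (mem (lift a) (lift b) (var 0)) (not (mem (lift a) (lift c) (var 0)))))

/-- Adjacency of `c` and `d` in the graph `b`. -/
def adj (a b c d : Expr) : Expr := nth a (nth a b c) d

/-- The union of two graphs. -/
def graphUnion (a b c : Expr) : Expr :=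
  tab a (tab (lift a) (or (adj (lift (lift a)) (lift (lift b)) (var 1) (var 0))
    (adj (lift (lift a)) (lift (lift c)) (var 1) (var 0))))

/-- The graph with the single edge from `b` to `c`. -/
def edge (a b c : Expr) : Expr :=
  tab a (tab (lift a) (or (and (eq (lift (lift b)) (var 1)) (eq (lift (lift c)) (var 0)))
    (and (eq (lift (lift b)) (var 0)) (eq (lift (lift c)) (var 1)))))

/-- The graph without edges. -/
def emptyGraph (a : Expr) : Expr := tab a (tab (lift a) (const 0))

section
variable {m n : ℕ} {a b c d : Expr} {ρ : List Val} {X X' : Set (Fin n)} {i j : Fin n}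
  {H H' : SimpleGraph (Fin n)}

theorem Ev.mem (hm : n ≤ m) (ha : a.Ev m ρ (downto n)) (hb : b.Ev m ρ (encodeSet X))
    (hc : c.Ev m ρ (.num i)) : (Expr.mem a b c).Ev m ρ (tv (i ∈ X)) :=
  Ev.nth (f := fun i => tv (i ∈ X)) ha hb hc hm

theorem Ev.union (hm : n ≤ m) (ha : a.Ev m ρ (downto n)) (hb : b.Ev m ρ (encodeSet X))
    (hc : c.Ev m ρ (encodeSet X')) : (Expr.union a b c).Ev m ρ (encodeSet (X ∪ X')) :=
  Ev.tab ha (fun _ => (Ev.mem hm ha.lift hb.lift (Ev.var rfl)).or fun _ =>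
    Ev.mem hm ha.lift hc.lift (Ev.var rfl)) hm

theorem Ev.inter (hm : n ≤ m) (ha : a.Ev m ρ (downto n)) (hb : b.Ev m ρ (encodeSet X))
    (hc : c.Ev m ρ (encodeSet X')) : (Expr.inter a b c).Ev m ρ (encodeSet (X ∩ X')) :=
  Ev.tab ha (fun _ => (Ev.mem hm ha.lift hb.lift (Ev.var rfl)).and fun _ =>
    Ev.mem hm ha.lift hc.lift (Ev.var rfl)) hm

theorem Ev.symmDiff (hm : n ≤ m) (ha : a.Ev m ρ (downto n)) (hb : b.Ev m ρ (encodeSet X))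
    (hc : c.Ev m ρ (encodeSet X')) :
    (Expr.symmDiff a b c).Ev m ρ (encodeSet {i | ¬(i ∈ X ↔ i ∈ X')}) :=
  Ev.tab ha (fun _ => ((Ev.mem hm ha.lift hb.lift (Ev.var rfl)).iff
    (Ev.mem hm ha.lift hc.lift (Ev.var rfl))).not) hm

theorem Ev.setEq (hm : n ≤ m) (ha : a.Ev m ρ (downto n)) (hb : b.Ev m ρ (encodeSet X))
    (hc : c.Ev m ρ (encodeSet X')) : (Expr.setEq a b c).Ev m ρ (tv (X = X')) := by
  rw [show (X = X') = ∀ i, i ∈ X ↔ i ∈ X' from propext Set.ext_iff]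
  exact Ev.all ha (fun _ => (Ev.mem hm ha.lift hb.lift (Ev.var rfl)).iff
    (Ev.mem hm ha.lift hc.lift (Ev.var rfl))) hm

theorem Ev.uncut (hm : n ≤ m) (ha : a.Ev m ρ (downto n)) (hb : b.Ev m ρ (encodeSet X))
    (hc : c.Ev m ρ (encodeSet X')) :
    (Expr.uncut a b c).Ev m ρ (tv (X ⊆ X' ∨ ∀ i, i ∈ X → i ∉ X')) :=
  (Ev.all ha (fun _ => (Ev.mem hm ha.lift hb.lift (Ev.var rfl)).imp
    (Ev.mem hm ha.lift hc.lift (Ev.var rfl))) hm).or fun _ =>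
  Ev.all ha (fun _ => (Ev.mem hm ha.lift hb.lift (Ev.var rfl)).imp
    (Ev.mem hm ha.lift hc.lift (Ev.var rfl)).not) hm

theorem Ev.adj (hm : n ≤ m) (ha : a.Ev m ρ (downto n)) (hb : b.Ev m ρ (encodeAdj H))
    (hc : c.Ev m ρ (.num i)) (hd : d.Ev m ρ (.num j)) :
    (Expr.adj a b c d).Ev m ρ (tv (H.Adj i j)) :=
  Ev.nth (f := fun j => tv (H.Adj i j)) ha
    (Ev.nth (f := fun i => table fun j => tv (H.Adj i j)) ha hb hc hm) hd hm

theorem Ev.graphUnion (hm : n ≤ m) (ha : a.Ev m ρ (downto n)) (hb : b.Ev m ρ (encodeAdj H))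
    (hc : c.Ev m ρ (encodeAdj H')) : (Expr.graphUnion a b c).Ev m ρ (encodeAdj (H ⊔ H')) :=
  Ev.tab ha (fun _ => Ev.tab ha.lift (fun _ =>
    (Ev.adj hm ha.lift.lift hb.lift.lift (Ev.var rfl) (Ev.var rfl)).or fun _ =>
      Ev.adj hm ha.lift.lift hc.lift.lift (Ev.var rfl) (Ev.var rfl)) hm) hm

theorem Ev.edge (hm : n ≤ m) (ha : a.Ev m ρ (downto n)) (hb : b.Ev m ρ (.num i))
    (hc : c.Ev m ρ (.num j)) (hij : i ≠ j) :
    (Expr.edge a b c).Ev m ρ (encodeAdj (SimpleGraph.edge i j)) := by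
  have h : ∀ x y : Fin n, (SimpleGraph.edge i j).Adj x y =
      (((i : ℕ) = x ∧ (j : ℕ) = y) ∨ ((i : ℕ) = y ∧ (j : ℕ) = x)) := by
    intro x y
    rw [SimpleGraph.edge_adj]
    simp only [← Fin.ext_iff, eq_iff_iff]
    grind
  unfold encodeAdj
  simp only [h]
  exact Ev.tab ha (fun _ => Ev.tab ha.lift (fun _ =>
    ((Ev.eq hb.lift.lift (Ev.var rfl)).and fun _ => Ev.eq hc.lift.lift (Ev.var rfl)).or fun _ =>
    (Ev.eq hb.lift.lift (Ev.var rfl)).and fun _ => Ev.eq hc.lift.lift (Ev.var rfl)) hm) hm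

theorem Ev.emptyGraph (hm : n ≤ m) (ha : a.Ev m ρ (downto n)) :
    (Expr.emptyGraph a).Ev m ρ (encodeAdj (⊥ : SimpleGraph (Fin n))) :=
  Ev.tab ha (fun _ => Ev.tab ha.lift (fun _ => by
    rw [tv_false (by simp)]; exact Ev.const) hm) hm

end

end Expr

end SteinerRep

namespace SteinerRep

/-! ### The table of connecting subgraphs -/

/-- A subgraph `H` of recorded cost `k` that connects `v` with the vertices of `X`. -/
structure Entry (n : ℕ) where
  X : Set (Fin n)
  v : Fin n
  k : ℕ
  H : SimpleGraph (Fin n)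

namespace Entry

variable {n : ℕ}

/-- Encoding of an entry. -/
noncomputable def enc (e : Entry n) : Val :=
  .pair (.pair (encodeSet e.X) (.num e.v)) (.pair (.num e.k) (encodeAdj e.H))

/-- What an entry connects. -/
def key (e : Entry n) : Set (Fin n) × Fin n := (e.X, e.v)

/-- The entry that joins two entries by an edge. -/
def comb (w : Sym2 (Fin n) → ℕ) (e f : Entry n) : Entry n where
  X := e.X ∪ f.X
  v := e.v
  k := e.k + f.k + w s(e.v, f.v)
  H := SimpleGraph.edge e.v f.v ⊔ (e.H ⊔ f.H)

/-- The entry of a single vertex. -/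
def single (Z : Set (Fin n)) (i : Fin n) : Entry n where
  X := {j | j = i ∧ j ∈ Z}
  v := i
  k := 0
  H := ⊥

end Entry

variable {n : ℕ}

/-- Encoding of a list of entries. -/
noncomputable def encodeEntries (T : List (Entry n)) : Val := .ofList (T.map Entry.enc)

/-- The total weight of the edges of `H`. -/
noncomputable def graphCost (w : Sym2 (Fin n) → ℕ) (H : SimpleGraph (Fin n)) : ℕ :=
  ∑ e, H.edgeSet.indicator w e

/-- Common edges are counted twice on the right. For this reason recorded costs are only upper
bounds. -/
theorem graphCost_sup_le (w : Sym2 (Fin n) → ℕ) (H H' : SimpleGraph (Fin n)) :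
    graphCost w (H ⊔ H') ≤ graphCost w H + graphCost w H' := by
  classical
  unfold graphCost
  rw [← Finset.sum_add_distrib, SimpleGraph.edgeSet_sup]
  refine Finset.sum_le_sum fun e _ => ?_
  by_cases h1 : e ∈ H.edgeSet <;> by_cases h2 : e ∈ H'.edgeSet <;> simp [h1, h2]

theorem graphCost_edge_le (w : Sym2 (Fin n) → ℕ) (i j : Fin n) :
    graphCost w (SimpleGraph.edge i j) ≤ w s(i, j) := by
  classical
  unfold graphCost
  rw [← Finset.sum_ite_eq' Finset.univ s(i, j) w |>.trans (if_pos (Finset.mem_univ _))]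
  refine Finset.sum_le_sum fun e _ => ?_
  rw [Set.indicator_apply]
  split_ifs with h1 h2
  · exact le_rfl
  · refine absurd ?_ h2
    induction e with | _ x y =>
    rw [SimpleGraph.mem_edgeSet, SimpleGraph.edge_adj] at h1
    rw [Sym2.eq_iff]
    grind
  all_goals exact Nat.zero_le _

@[simp] theorem graphCost_bot (w : Sym2 (Fin n) → ℕ) : graphCost w ⊥ = 0 := by
  simp [graphCost]

/-- All edges of `H` are edges of `G` inside `S`. -/
def Within (G : SimpleGraph (Fin n)) (S : Set (Fin n)) (H : SimpleGraph (Fin n)) : Prop :=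
  ∀ x y, H.Adj x y → G.Adj x y ∧ x ∈ S ∧ y ∈ S

theorem Within.sup {G H H' : SimpleGraph (Fin n)} {S : Set (Fin n)} (h : Within G S H)
    (h' : Within G S H') : Within G S (H ⊔ H') := by
  rintro x y (hxy | hxy)
  exacts [h x y hxy, h' x y hxy]

theorem Within.bot {G : SimpleGraph (Fin n)} {S : Set (Fin n)} : Within G S ⊥ :=
  fun _ _ h => h.elim

theorem Within.edge {G : SimpleGraph (Fin n)} {S : Set (Fin n)} {i j : Fin n} (h : G.Adj i j)
    (hi : i ∈ S) (hj : j ∈ S) : Within G S (SimpleGraph.edge i j) := by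
  intro x y hxy
  rw [SimpleGraph.edge_adj] at hxy
  have := h.symm
  grind

/-- The properties of the entries that the algorithm generates. -/
structure Entry.Valid (G : SimpleGraph (Fin n)) (w : Sym2 (Fin n) → ℕ) (S Z : Set (Fin n))
    (e : Entry n) : Prop where
  subset : e.X ⊆ Z
  within : Within G S e.H
  cost_le : graphCost w e.H ≤ e.k
  reach : ∀ x ∈ e.X, e.H.Reachable e.v x

/-- Two entries can be joined by an edge. -/
def Entry.Linked (G : SimpleGraph (Fin n)) (S : Set (Fin n)) (e f : Entry n) : Prop :=
  G.Adj e.v f.v ∧ e.v ∈ S ∧ f.v ∈ S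

theorem Entry.Valid.comb {G : SimpleGraph (Fin n)} {w : Sym2 (Fin n) → ℕ} {S Z : Set (Fin n)}
    {e f : Entry n} (he : e.Valid G w S Z) (hf : f.Valid G w S Z) (h : e.Linked G S f) :
    (e.comb w f).Valid G w S Z where
  subset := Set.union_subset he.subset hf.subset
  within := (Within.edge h.1 h.2.1 h.2.2).sup (he.within.sup hf.within)
  cost_le := by
    have h1 := graphCost_sup_le w (SimpleGraph.edge e.v f.v) (e.H ⊔ f.H)
    have h2 := graphCost_sup_le w e.H f.H
    have h3 := graphCost_edge_le w e.v f.v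
    have h4 := he.cost_le
    have h5 := hf.cost_le
    simp only [Entry.comb]
    omega
  reach := by
    rintro x (hx | hx)
    · exact (he.reach x hx).mono (le_sup_left.trans le_sup_right)
    · have h1 : (e.comb w f).H.Reachable e.v f.v :=
        SimpleGraph.Adj.reachable (Or.inl (by simp [SimpleGraph.edge_adj, h.1.ne]))
      exact h1.trans ((hf.reach x hx).mono (le_sup_right.trans le_sup_right))

theorem Entry.Valid.single (G : SimpleGraph (Fin n)) (w : Sym2 (Fin n) → ℕ) (S Z : Set (Fin n))
    (i : Fin n) : (Entry.single Z i).Valid G w S Z where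
  subset := fun _ h => h.2
  within := Within.bot
  cost_le := by simp [Entry.single]
  reach := by
    rintro x ⟨rfl, -⟩
    exact SimpleGraph.Reachable.refl _

/-! ### Domination and completeness of tables -/

/-- `T` has an entry that connects what `e` connects at no higher cost. -/
def Dominates (T : List (Entry n)) (e : Entry n) : Prop := ∃ f ∈ T, f.key = e.key ∧ f.k ≤ e.k

theorem Dominates.trans {T T' : List (Entry n)} {e : Entry n} (h : Dominates T e)
    (h' : ∀ f ∈ T, Dominates T' f) : Dominates T' e := by
  obtain ⟨f, hf, hk, hc⟩ := h
  obtain ⟨g, hg, hk', hc'⟩ := h' f hf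
  exact ⟨g, hg, hk'.trans hk, hc'.trans hc⟩

/-- The key of a join depends only on the two keys, and its cost is monotone in the two costs, so
dominating entries can take the place of `e` and `f`. -/
theorem dominates_comb {T T' : List (Entry n)} {e f : Entry n} {G : SimpleGraph (Fin n)}
    {w : Sym2 (Fin n) → ℕ} {S : Set (Fin n)}
    (h : ∀ x ∈ T, ∀ y ∈ T, x.Linked G S y → Dominates T' (x.comb w y))
    (he : Dominates T e) (hf : Dominates T f) (hl : e.Linked G S f) :
    Dominates T' (e.comb w f) := by
  obtain ⟨⟨X, i, k, H⟩, hx, hxk, hxc⟩ := he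
  obtain ⟨⟨X', i', k', H'⟩, hy, hyk, hyc⟩ := hf
  obtain ⟨rfl, rfl⟩ := Prod.ext_iff.1 hxk
  obtain ⟨rfl, rfl⟩ := Prod.ext_iff.1 hyk
  obtain ⟨z, hz, hzk, hzc⟩ := h _ hx _ hy hl
  refine ⟨z, hz, hzk, hzc.trans ?_⟩
  simp only [Entry.comb, Entry.key] at hxc hyc ⊢
  omega

/-- The edges of `F` in the connected component of `v`. -/
def reachEdges (F : SimpleGraph (Fin n)) (v : Fin n) : Set (Sym2 (Fin n)) :=
  {e | e ∈ F.edgeSet ∧ ∃ x ∈ e, F.Reachable v x}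

/-- The entry that describes the connected component of `v` in `F`. -/
noncomputable def Entry.ofGraph (w : Sym2 (Fin n) → ℕ) (Z : Set (Fin n)) (F : SimpleGraph (Fin n))
    (v : Fin n) : Entry n where
  X := {x | x ∈ Z ∧ F.Reachable v x}
  v := v
  k := ∑ e, (reachEdges F v).indicator w e
  H := ⊥

/-- Along a walk from `v`, each traversal of the edge `vu` ends at `v` or at `u`, and the walk after
the last traversal survives the deletion. -/
theorem reachable_iff_deleteEdges {F : SimpleGraph (Fin n)} {v u : Fin n} (h : F.Adj v u)
    (x : Fin n) : F.Reachable v x ↔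
      (F.deleteEdges {s(v, u)}).Reachable v x ∨ (F.deleteEdges {s(v, u)}).Reachable u x := by
  constructor
  · intro hx
    rw [SimpleGraph.reachable_iff_reflTransGen] at hx
    induction hx with
    | refl => exact Or.inl (SimpleGraph.Reachable.refl _)
    | @tail y z _ hyz ih =>
      by_cases he : s(y, z) = s(v, u)
      · rcases Sym2.eq_iff.1 he with ⟨rfl, rfl⟩ | ⟨rfl, rfl⟩
        · exact Or.inr (SimpleGraph.Reachable.refl _)
        · exact Or.inl (SimpleGraph.Reachable.refl _)
      · have hadj : (F.deleteEdges {s(v, u)}).Adj y z := by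
          rw [SimpleGraph.deleteEdges_adj]
          exact ⟨hyz, he⟩
        exact ih.imp (fun h => h.trans hadj.reachable) fun h => h.trans hadj.reachable
  · rintro (hx | hx)
    · exact hx.mono (SimpleGraph.deleteEdges_le _)
    · exact h.reachable.trans (hx.mono (SimpleGraph.deleteEdges_le _))

theorem reachEdges_mono {F F' : SimpleGraph (Fin n)} (h : F' ≤ F) {v u : Fin n}
    (hv : F.Reachable v u) : reachEdges F' u ⊆ reachEdges F v :=
  fun _ ⟨he, x, hx, hr⟩ => ⟨SimpleGraph.edgeSet_mono h he, x, hx, hv.trans (hr.mono h)⟩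

/-- Once the deletion separates `v` from `u`, the edges on the two sides and the edge `vu` itself
are disjoint parts of the old component. The sums are compared edge by edge. -/
theorem sum_reachEdges_deleteEdges_le (w : Sym2 (Fin n) → ℕ) {F : SimpleGraph (Fin n)}
    {v u : Fin n} (h : F.Adj v u) (hvu : ¬(F.deleteEdges {s(v, u)}).Reachable v u) :
    ∑ e, (reachEdges (F.deleteEdges {s(v, u)}) v).indicator w e +
      ∑ e, (reachEdges (F.deleteEdges {s(v, u)}) u).indicator w e + w s(v, u) ≤
    ∑ e, (reachEdges F v).indicator w e := by
  classical
  have hle : F.deleteEdges {s(v, u)} ≤ F := SimpleGraph.deleteEdges_le _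
  rw [← Finset.sum_ite_eq' Finset.univ s(v, u) w |>.trans (if_pos (Finset.mem_univ _)),
    ← Finset.sum_add_distrib, ← Finset.sum_add_distrib]
  refine Finset.sum_le_sum fun e _ => ?_
  have h1 := @reachEdges_mono n _ _ hle v v (SimpleGraph.Reachable.refl _) e
  have h2 := @reachEdges_mono n _ _ hle v u h.reachable e
  have h3 : e = s(v, u) → e ∈ reachEdges F v := by
    rintro rfl
    exact ⟨h, v, by simp, SimpleGraph.Reachable.refl _⟩
  have h4 : ∀ z, e ∈ reachEdges (F.deleteEdges {s(v, u)}) z → e ≠ s(v, u) := by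
    rintro z ⟨he, -⟩ rfl
    rw [SimpleGraph.mem_edgeSet, SimpleGraph.deleteEdges_adj] at he
    exact he.2 rfl
  have h5 : e ∈ reachEdges (F.deleteEdges {s(v, u)}) v →
      e ∉ reachEdges (F.deleteEdges {s(v, u)}) u := by
    rintro ⟨he, x, hx, hvx⟩ ⟨-, y, hy, huy⟩
    refine hvu (hvx.trans (SimpleGraph.Reachable.trans ?_ huy.symm))
    by_cases hxy : x = y
    · rw [hxy]
    · rw [((Sym2.mem_and_mem_iff hxy).1 ⟨hx, hy⟩), SimpleGraph.mem_edgeSet] at he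
      exact he.reachable
  simp only [Set.indicator_apply]
  by_cases c1 : e ∈ reachEdges (F.deleteEdges {s(v, u)}) v <;>
    by_cases c2 : e ∈ reachEdges (F.deleteEdges {s(v, u)}) u <;>
    by_cases c3 : e = s(v, u) <;> simp_all

/-- `T` dominates the components of all graphs with at most `r` edges. -/
def Complete (G : SimpleGraph (Fin n)) (w : Sym2 (Fin n) → ℕ) (S Z : Set (Fin n)) (r : ℕ)
    (T : List (Entry n)) : Prop :=
  ∀ F : SimpleGraph (Fin n), Within G S F → F.edgeSet.ncard ≤ r →
    ∀ v, Dominates T (Entry.ofGraph w Z F v)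

theorem dominates_ofGraph_of_isolated {w : Sym2 (Fin n) → ℕ} {Z : Set (Fin n)}
    {T : List (Entry n)} {F : SimpleGraph (Fin n)} {v : Fin n} (hF : ∀ u, ¬F.Adj v u)
    (h : Dominates T (Entry.single Z v)) : Dominates T (Entry.ofGraph w Z F v) := by
  have hr : ∀ x, F.Reachable v x ↔ x = v := by
    refine fun x => ⟨?_, fun h => h ▸ SimpleGraph.Reachable.refl _⟩
    rintro ⟨p⟩
    cases p with
    | nil => rfl
    | cons h _ => exact absurd h (hF _)
  obtain ⟨e, he, hk, hc⟩ := h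
  refine ⟨e, he, hk.trans ?_, hc.trans (Nat.zero_le _)⟩
  simp [Entry.key, Entry.single, Entry.ofGraph, hr, and_comm]

theorem Complete.zero {G : SimpleGraph (Fin n)} {w : Sym2 (Fin n) → ℕ} {S Z : Set (Fin n)}
    {T : List (Entry n)} (h : ∀ i, Dominates T (Entry.single Z i)) : Complete G w S Z 0 T := by
  intro F _ hF v
  refine dominates_ofGraph_of_isolated (fun u huv => ?_) (h v)
  have := (Set.ncard_eq_zero (Set.toFinite _)).1 (Nat.le_zero.1 hF)
  exact this.subset (show s(v, u) ∈ F.edgeSet from huv)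

/-- Delete an edge `vu` at `v`. If `v` and `u` stay connected, the component keeps its vertices and
does not get dearer. Otherwise it falls into the components of `v` and `u`, whose dominating entries
are joined along `vu`. Both cases concern a graph with one edge fewer. -/
theorem Complete.succ {G : SimpleGraph (Fin n)} {w : Sym2 (Fin n) → ℕ} {S Z : Set (Fin n)}
    {T T' : List (Entry n)} {r : ℕ} (h : Complete G w S Z r T) (hd : ∀ e ∈ T, Dominates T' e)
    (hs : ∀ i, Dominates T (Entry.single Z i))
    (hc : ∀ x ∈ T, ∀ y ∈ T, x.Linked G S y → Dominates T' (x.comb w y)) :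
    Complete G w S Z (r + 1) T' := by
  intro F hF hr v
  by_cases hv : ∀ u, ¬F.Adj v u
  · exact dominates_ofGraph_of_isolated hv ((hs v).trans hd)
  push Not at hv
  obtain ⟨u, hu⟩ := hv
  set F' := F.deleteEdges {s(v, u)} with hF'
  have hle : F' ≤ F := SimpleGraph.deleteEdges_le _
  have hw : Within G S F' := fun x y hxy => hF x y (hle hxy)
  have hr' : F'.edgeSet.ncard ≤ r := by
    rw [hF', SimpleGraph.edgeSet_deleteEdges]
    have := Set.ncard_sdiff_singleton_add_one (show s(v, u) ∈ F.edgeSet from hu) (Set.toFinite _)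
    omega
  by_cases hvu : F'.Reachable v u
  · obtain ⟨e, he, hk, hke⟩ := (h F' hw hr' v).trans hd
    refine ⟨e, he, hk.trans ?_, hke.trans ?_⟩
    · have : ∀ x, F.Reachable v x ↔ F'.Reachable v x := fun x => by
        rw [reachable_iff_deleteEdges hu]
        exact or_iff_left_of_imp fun hx => hvu.trans hx
      simp [Entry.key, Entry.ofGraph, this]
    · change ∑ e, (reachEdges F' v).indicator w e ≤ ∑ e, (reachEdges F v).indicator w e
      refine Finset.sum_le_sum fun e _ => ?_
      exact Set.indicator_le_indicator_of_subset
        (reachEdges_mono hle (SimpleGraph.Reachable.refl _)) (fun _ => Nat.zero_le _) e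
  · have hl : (Entry.ofGraph w Z F' v).Linked G S (Entry.ofGraph w Z F' u) := hF v u hu
    obtain ⟨e, he, hk, hke⟩ := dominates_comb hc (h F' hw hr' v) (h F' hw hr' u) hl
    refine ⟨e, he, hk.trans ?_, hke.trans (sum_reachEdges_deleteEdges_le w hu hvu)⟩
    simp only [Entry.key, Entry.ofGraph, Entry.comb, reachable_iff_deleteEdges hu, Prod.mk.injEq,
      and_true]
    ext x
    simp [hF', and_or_left]

/-- The properties of the tables that the algorithm generates. -/
structure ValidTable (G : SimpleGraph (Fin n)) (w : Sym2 (Fin n) → ℕ) (S Z : Set (Fin n))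
    (T : List (Entry n)) : Prop where
  nodup : (T.map Entry.key).Nodup
  valid : ∀ e ∈ T, e.Valid G w S Z

/-- Distinct entries have distinct keys, and a key is a subset of `Z` with a vertex. This bounds all
loops over tables. -/
theorem ValidTable.length_le {G : SimpleGraph (Fin n)} {w : Sym2 (Fin n) → ℕ} {S : Set (Fin n)}
    {Z : Finset (Fin n)} {T : List (Entry n)} (h : ValidTable G w S Z T) :
    T.length ≤ n * 2 ^ Z.card := by
  classical
  have hsub : (T.map Entry.key).toFinset ⊆
      (Z.powerset.image fun A : Finset (Fin n) => (A : Set (Fin n))) ×ˢ Finset.univ := by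
    intro p hp
    simp only [List.mem_toFinset, List.mem_map] at hp
    obtain ⟨e, he, rfl⟩ := hp
    simp only [Finset.mem_product, Finset.mem_image, Finset.mem_powerset, Finset.mem_univ, and_true]
    exact ⟨Finset.univ.filter (· ∈ e.X), fun x hx =>
      (h.valid e he).subset (Finset.mem_filter.1 hx).2, by ext; simp [Entry.key]⟩
  have := Finset.card_le_card hsub
  rw [List.toFinset_card_of_nodup h.nodup, Finset.card_product, List.length_map] at this
  refine this.trans ?_
  rw [Finset.card_univ, Fintype.card_fin, mul_comm]
  exact Nat.mul_le_mul_left _ (Finset.card_image_le.trans (by simp))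

/-! ### Programs that fill the table, and their correctness -/

namespace Expr

/-- The set of an entry. -/
def entX (e : Expr) : Expr := fst (fst e)
/-- The vertex of an entry. -/
def entV (e : Expr) : Expr := snd (fst e)
/-- The cost of an entry. -/
def entK (e : Expr) : Expr := fst (snd e)
/-- The graph of an entry. -/
def entH (e : Expr) : Expr := snd (snd e)

/-- The entry at the position of the edge between the vertices of two entries. -/
def edgeEntry (a g e f : Expr) : Expr := nth a (nth a g (entV e)) (entV f)

/-- Whether two entries can be joined by an edge inside `s`. -/
def linked (a g s e f : Expr) : Expr :=
  and (isPair (edgeEntry a g e f)) (and (mem a s (entV e)) (mem a s (entV f)))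

/-- The join of two entries by an edge. -/
def comb (a g e f : Expr) : Expr :=
  pair (pair (union a (entX e) (entX f)) (entV e))
    (pair (add (add (entK e) (entK f)) (snd (edgeEntry a g e f)))
      (graphUnion a (edge a (entV e) (entV f)) (graphUnion a (entH e) (entH f))))

/-- Whether two entries have the same key. -/
def sameKey (a e f : Expr) : Expr :=
  and (setEq a (entX e) (entX f)) (eq (entV e) (entV f))

/-- Insertion of an entry into a table. -/
def insert (a e t : Expr) : Expr :=
  -- The head of the accumulator is the cheapest entry so far with the key of `e`; its tail collects
  -- the entries with other keys.
  fold t (pair e (const 0))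
    (ite (sameKey (lift (lift a)) (fst (var 0)) (var 1))
      (ite (le (entK (var 1)) (entK (fst (var 0)))) (pair (var 1) (snd (var 0))) (var 0))
      (pair (fst (var 0)) (pair (var 1) (snd (var 0)))))

/-- Insertion of all joins of two entries into a table. -/
def relax (a g s t : Expr) : Expr :=
  -- Both loops run over the old table, so their lengths stay bounded while the accumulator grows.
  -- In the inner body, `var 3` and `var 1` are the two entries and `var 0` is the new table.
  fold t t (fold (lift (lift t)) (var 0)
    (ite (linked (lift (lift (lift (lift a)))) (lift (lift (lift (lift g))))
        (lift (lift (lift (lift s)))) (var 3) (var 1))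
      (insert (lift (lift (lift (lift a))))
        (comb (lift (lift (lift (lift a)))) (lift (lift (lift (lift g)))) (var 3) (var 1)) (var 0))
      (var 0)))

/-- The table of the single vertices. -/
def singles (a z : Expr) : Expr :=
  tab a (pair (pair (tab (lift a)
      (and (eq (var 0) (var 1)) (mem (lift (lift a)) (lift (lift z)) (var 0)))) (var 0))
    (pair (const 0) (emptyGraph (lift a))))

/-- The table of connecting subgraphs. -/
def entries (a g s z : Expr) : Expr :=
  -- Two nested loops over the vertices make `n * n` rounds, at least the number of edges of any
  -- graph on `n` vertices.
  fold a (singles a z) (fold (lift (lift a)) (var 0)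
    (relax (lift (lift (lift (lift a)))) (lift (lift (lift (lift g))))
      (lift (lift (lift (lift s)))) (var 0)))

section
variable {m : ℕ} {a g s z e f t : Expr} {ρ : List Val} {x y : Entry n} {G : SimpleGraph (Fin n)}
  {w : Sym2 (Fin n) → ℕ} {S : Set (Fin n)}

theorem Ev.entX (he : e.Ev m ρ x.enc) : (Expr.entX e).Ev m ρ (encodeSet x.X) :=
  Ev.fst (Ev.fst he)

theorem Ev.entV (he : e.Ev m ρ x.enc) : (Expr.entV e).Ev m ρ (.num x.v) :=
  Ev.snd (Ev.fst he)

theorem Ev.entK (he : e.Ev m ρ x.enc) : (Expr.entK e).Ev m ρ (.num x.k) :=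
  Ev.fst (Ev.snd he)

theorem Ev.entH (he : e.Ev m ρ x.enc) : (Expr.entH e).Ev m ρ (encodeAdj x.H) :=
  Ev.snd (Ev.snd he)

open Classical in
theorem Ev.edgeEntry (hm : n ≤ m) (ha : a.Ev m ρ (downto n)) (hg : g.Ev m ρ (encodeGraph G w))
    (he : e.Ev m ρ x.enc) (hf : f.Ev m ρ y.enc) :
    (Expr.edgeEntry a g e f).Ev m ρ
      (if G.Adj x.v y.v then .pair (.num 0) (.num (w s(x.v, y.v))) else .num 0) :=
  Ev.nth (f := fun j => if G.Adj x.v j then .pair (.num 0) (.num (w s(x.v, j))) else .num 0) ha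
    (Ev.nth (f := fun i => table fun j =>
      if G.Adj i j then .pair (.num 0) (.num (w s(i, j))) else .num 0) ha hg he.entV hm) hf.entV hm

theorem Ev.linked (hm : n ≤ m) (ha : a.Ev m ρ (downto n)) (hg : g.Ev m ρ (encodeGraph G w))
    (hs : s.Ev m ρ (encodeSet S)) (he : e.Ev m ρ x.enc) (hf : f.Ev m ρ y.enc) :
    (Expr.linked a g s e f).Ev m ρ (tv (x.Linked G S y)) := by
  refine Ev.and ?_ fun _ => (Ev.mem hm ha hs he.entV).and fun _ => Ev.mem hm ha hs hf.entV
  have := Ev.isPair (Ev.edgeEntry hm ha hg he hf)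
  by_cases h : G.Adj x.v y.v
  · simpa [h, Val.isPair] using this
  · simpa [h, Val.isPair] using this

theorem Ev.comb (hm : n ≤ m) (ha : a.Ev m ρ (downto n)) (hg : g.Ev m ρ (encodeGraph G w))
    (he : e.Ev m ρ x.enc) (hf : f.Ev m ρ y.enc) (h : G.Adj x.v y.v) :
    (Expr.comb a g e f).Ev m ρ (x.comb w y).enc := by
  have hw := Ev.edgeEntry hm ha hg he hf
  rw [if_pos h] at hw
  exact ((Ev.union hm ha he.entX hf.entX).pair he.entV).pair
    (((he.entK.add hf.entK).add hw.snd).pair (Ev.graphUnion hm ha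
      (Ev.edge hm ha he.entV hf.entV h.ne) (Ev.graphUnion hm ha he.entH hf.entH)))

theorem Ev.sameKey (hm : n ≤ m) (ha : a.Ev m ρ (downto n)) (he : e.Ev m ρ x.enc)
    (hf : f.Ev m ρ y.enc) : (Expr.sameKey a e f).Ev m ρ (tv (x.key = y.key)) := by
  rw [show (x.key = y.key) = (x.X = y.X ∧ (x.v : ℕ) = y.v) by
    simp [Entry.key, Prod.ext_iff, Fin.ext_iff]]
  exact (Ev.setEq hm ha he.entX hf.entX).and fun _ => Ev.eq he.entV hf.entV

theorem Wp.insert {T : List (Entry n)} (hm : n ≤ m) (ha : a.Ev m ρ (downto n))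
    (he : e.Ev m ρ x.enc) (ht : t.Ev m ρ (encodeEntries T)) (hT : (T.map Entry.key).Nodup)
    (hl : T.length ≤ m) :
    (Expr.insert a e t).Wp m ρ fun v => ∃ T' : List (Entry n), v = encodeEntries T' ∧
      (T'.map Entry.key).Nodup ∧ (∀ y ∈ T', y = x ∨ y ∈ T) ∧ Dominates T' x ∧
      ∀ y ∈ T, Dominates T' y := by
  refine Wp.fold (fun pre v => ∃ (x' : Entry n) (out : List (Entry n)),
    v = encodeEntries (x' :: out) ∧ x'.key = x.key ∧ (x' = x ∨ x' ∈ pre) ∧ x'.k ≤ x.k ∧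
    (∀ y ∈ pre, y.key = x.key → x'.k ≤ y.k) ∧ (∀ y, y ∈ out ↔ y ∈ pre ∧ y.key ≠ x.key) ∧
    (out.map Entry.key).Nodup) ht (Ev.pair he Ev.const) hl
    ⟨x, [], rfl, rfl, Or.inl rfl, le_rfl, by simp, by simp, by simp⟩ ?_ ?_
  · rintro pre y post hpre acc ⟨x', out, rfl, hk, hx, hc, hle, hout, hnd⟩
    have ha' : (Expr.lift (.lift a)).Ev m (encodeEntries (x' :: out) :: y.enc :: ρ) (downto n) := ha
    have h1 : (Expr.fst (.var 0)).Ev m (encodeEntries (x' :: out) :: y.enc :: ρ) x'.enc :=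
      Ev.fst (Ev.var rfl)
    have h2 : (Expr.var 1).Ev m (encodeEntries (x' :: out) :: y.enc :: ρ) y.enc := Ev.var rfl
    have h3 : (Expr.snd (.var 0)).Ev m (encodeEntries (x' :: out) :: y.enc :: ρ)
      (encodeEntries out) := Ev.snd (Ev.var rfl)
    refine (Ev.sameKey hm ha' h1 h2).iteWp (fun h => ?_) fun h => ?_
    · have hout' : ∀ z, z ∈ out ↔ z ∈ pre ++ [y] ∧ z.key ≠ x.key := by
        intro z
        rw [hout]
        have := h.symm.trans hk
        grind
      refine (Ev.le h2.entK h1.entK).iteWp (fun h' => ?_) fun h' => ?_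
      · refine h2.pair h3 _ ⟨y, out, rfl, h.symm.trans hk, by simp, h'.trans hc, ?_, hout', hnd⟩
        intro z hz hzk
        rcases List.mem_append.1 hz with hz | hz
        · exact h'.trans (hle z hz hzk)
        · rw [List.mem_singleton.1 hz]
      · refine ⟨x', out, rfl, hk, by grind, hc, ?_, hout', hnd⟩
        intro z hz hzk
        rcases List.mem_append.1 hz with hz | hz
        · exact hle z hz hzk
        · rw [List.mem_singleton.1 hz]; omega
    · refine h1.pair (h2.pair h3) _ ⟨x', y :: out, rfl, hk, by grind, hc, ?_, ?_, ?_⟩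
      · intro z hz hzk
        rcases List.mem_append.1 hz with hz | hz
        · exact hle z hz hzk
        · exact absurd (hk.trans (by rw [← hzk, List.mem_singleton.1 hz])) h
      · intro z
        have := fun hh : y.key = x.key => h (hk.trans hh.symm)
        grind
      · refine List.nodup_cons.2 ⟨fun hmem => ?_, hnd⟩
        obtain ⟨z, hz, hzk⟩ := List.mem_map.1 hmem
        have hz' := ((hout z).1 hz).1
        rw [hpre, List.map_append, List.nodup_append] at hT
        exact hT.2.2 _ (List.mem_map_of_mem hz') _ (by simp) hzk
  · rintro v ⟨x', out, rfl, hk, hx, hc, hle, hout, hnd⟩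
    refine ⟨x' :: out, rfl, ?_, ?_, ⟨x', by simp, hk, hc⟩, fun y hy => ?_⟩
    · refine List.nodup_cons.2 ⟨fun hmem => ?_, hnd⟩
      obtain ⟨z, hz, hzk⟩ := List.mem_map.1 hmem
      exact ((hout z).1 hz).2 (hzk.trans hk)
    · intro y hy
      rcases List.mem_cons.1 hy with rfl | hy
      · exact hx
      · exact Or.inr ((hout y).1 hy).1
    · by_cases h : y.key = x.key
      · exact ⟨x', by simp, hk.trans h.symm, hle y hy h⟩
      · exact ⟨y, List.mem_cons_of_mem _ ((hout y).2 ⟨hy, h⟩), rfl, le_rfl⟩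

theorem Wp.relax {Z : Finset (Fin n)} {T : List (Entry n)} (hm : n ≤ m) (hm' : n * 2 ^ Z.card ≤ m)
    (ha : a.Ev m ρ (downto n)) (hg : g.Ev m ρ (encodeGraph G w)) (hs : s.Ev m ρ (encodeSet S))
    (ht : t.Ev m ρ (encodeEntries T)) (hT : ValidTable G w S Z T) :
    (Expr.relax a g s t).Wp m ρ fun v => ∃ T' : List (Entry n), v = encodeEntries T' ∧
      ValidTable G w S Z T' ∧ (∀ x ∈ T, Dominates T' x) ∧
      ∀ x ∈ T, ∀ y ∈ T, x.Linked G S y → Dominates T' (x.comb w y) := by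
  have hl := hT.length_le.trans hm'
  refine Wp.fold (fun pre v => ∃ T' : List (Entry n), v = encodeEntries T' ∧
      ValidTable G w S Z T' ∧ (∀ x ∈ T, Dominates T' x) ∧
      ∀ x ∈ pre, ∀ y ∈ T, x.Linked G S y → Dominates T' (x.comb w y)) ht ht hl
    ⟨T, rfl, hT, fun x hx => ⟨x, hx, rfl, le_rfl⟩, by simp⟩ ?_ fun v hv => hv
  rintro pre x post hpre acc ⟨T₁, rfl, hT₁, hd₁, hc₁⟩
  refine Wp.fold (fun pre' v => ∃ T' : List (Entry n), v = encodeEntries T' ∧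
      ValidTable G w S Z T' ∧ (∀ x ∈ T₁, Dominates T' x) ∧
      ∀ y ∈ pre', x.Linked G S y → Dominates T' (x.comb w y)) ht.lift.lift (Ev.var rfl) hl
    ⟨T₁, rfl, hT₁, fun x hx => ⟨x, hx, rfl, le_rfl⟩, by simp⟩ ?_ ?_
  · rintro pre' y post' hpre' acc ⟨T₂, rfl, hT₂, hd₂, hc₂⟩
    have h3 : (Expr.var 3).Ev m (encodeEntries T₂ :: y.enc :: encodeEntries T₁ :: x.enc :: ρ)
      x.enc := Ev.var rfl
    have h1 : (Expr.var 1).Ev m (encodeEntries T₂ :: y.enc :: encodeEntries T₁ :: x.enc :: ρ)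
      y.enc := Ev.var rfl
    refine (Ev.linked hm ha.lift.lift.lift.lift hg.lift.lift.lift.lift hs.lift.lift.lift.lift
      h3 h1).iteWp (fun h => ?_) fun h => ?_
    · refine (Wp.insert (T := T₂) hm ha.lift.lift.lift.lift (Ev.comb hm ha.lift.lift.lift.lift
        hg.lift.lift.lift.lift h3 h1 h.1) (Ev.var rfl) hT₂.nodup (hT₂.length_le.trans hm')).mono ?_
      rintro v ⟨T₃, rfl, hnd, hmem, hdx, hd₃⟩
      refine ⟨T₃, rfl, ⟨hnd, fun e he => ?_⟩, fun e he => (hd₂ e he).trans hd₃, fun e he hle => ?_⟩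
      · rcases hmem e he with rfl | he
        · exact (hT.valid x (by simp [hpre])).comb (hT.valid y (by simp [hpre'])) h
        · exact hT₂.valid e he
      · rcases List.mem_append.1 he with he | he
        · exact (hc₂ e he hle).trans hd₃
        · rw [List.mem_singleton.1 he]; exact hdx
    · refine ⟨T₂, rfl, hT₂, hd₂, fun e he hle => ?_⟩
      rcases List.mem_append.1 he with he | he
      · exact hc₂ e he hle
      · rw [List.mem_singleton.1 he] at hle; exact absurd hle h
  · rintro v ⟨T', rfl, hT', hd', hc'⟩
    refine ⟨T', rfl, hT', fun e he => (hd₁ e he).trans hd', fun e he y hy hle => ?_⟩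
    rcases List.mem_append.1 he with he | he
    · exact (hc₁ e he y hy hle).trans hd'
    · rw [List.mem_singleton.1 he] at hle ⊢; exact hc' y hy hle

theorem Ev.singles {Z : Set (Fin n)} (hm : n ≤ m) (ha : a.Ev m ρ (downto n))
    (hz : z.Ev m ρ (encodeSet Z)) :
    (Expr.singles a z).Ev m ρ (encodeEntries ((List.finRange n).map (Entry.single Z))) := by
  have : (Expr.singles a z).Ev m ρ (table fun i => (Entry.single Z i).enc) := by
    refine Ev.tab ha (fun i => Ev.pair (Ev.pair ?_ (Ev.var rfl))
      (Ev.pair Ev.const (Ev.emptyGraph hm ha.lift))) hm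
    refine Ev.tab (g := fun j => tv (j = i ∧ j ∈ Z)) ha.lift (fun j => ?_) hm
    rw [show (j = i) = ((j : ℕ) = i) by simp [Fin.ext_iff]]
    exact (Ev.eq (Ev.var rfl) (Ev.var rfl)).and fun _ => Ev.mem hm ha.lift.lift hz.lift.lift
      (Ev.var rfl)
  rw [table, List.ofFn_eq_map] at this
  rwa [encodeEntries, List.map_map]

/-- Each call of `relax` raises by one the number of edges up to which the table is complete, and no
graph has more than `n.choose 2` edges. -/
theorem Wp.entries {Z : Finset (Fin n)} (hm : n ≤ m) (hm' : n * 2 ^ Z.card ≤ m)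
    (ha : a.Ev m ρ (downto n)) (hg : g.Ev m ρ (encodeGraph G w)) (hs : s.Ev m ρ (encodeSet S))
    (hz : z.Ev m ρ (encodeSet (Z : Set (Fin n)))) :
    (Expr.entries a g s z).Wp m ρ fun v => ∃ T : List (Entry n), v = encodeEntries T ∧
      ValidTable G w S Z T ∧ ∀ F : SimpleGraph (Fin n), Within G S F →
        ∀ v, Dominates T (Entry.ofGraph w Z F v) := by
  let I : ℕ → Val → Prop := fun r v => ∃ T : List (Entry n), v = encodeEntries T ∧
    ValidTable G w S Z T ∧ (∀ i, Dominates T (Entry.single Z i)) ∧ Complete G w S Z r T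
  have h0 : ∀ i : Fin n, Dominates ((List.finRange n).map (Entry.single (Z : Set (Fin n))))
      (Entry.single Z i) := fun i =>
    ⟨_, List.mem_map_of_mem (List.mem_finRange i), rfl, le_rfl⟩
  refine Wp.fold (fun pre => I (pre.length * n)) ha (Ev.singles hm ha hz) (by simpa using hm)
    ⟨_, rfl, ⟨?_, ?_⟩, h0, by simpa using Complete.zero h0⟩ ?_ ?_
  · rw [List.map_map]
    exact (List.nodup_finRange n).map fun i j hij => (Prod.ext_iff.1 hij).2
  · intro e he
    obtain ⟨i, -, rfl⟩ := List.mem_map.1 he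
    exact Entry.Valid.single G w S Z i
  · rintro pre x post hpre acc hI
    refine Wp.fold (fun pre' => I (pre.length * n + pre'.length)) ha.lift.lift (Ev.var rfl)
      (by simpa using hm) hI ?_ ?_
    · rintro pre' y post' hpre' acc ⟨T, rfl, hT, hsingle, hT'⟩
      refine (Wp.relax hm hm' ha.lift.lift.lift.lift hg.lift.lift.lift.lift hs.lift.lift.lift.lift
        (Ev.var rfl) hT).mono ?_
      rintro v ⟨T₁, rfl, hT₁, hd, hc⟩
      refine ⟨T₁, rfl, hT₁, fun i => (hsingle i).trans hd, ?_⟩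
      rw [List.length_append, ← add_assoc]
      exact hT'.succ hd hsingle hc
    · intro v hv
      simpa [add_mul] using hv
  · rintro v ⟨T, rfl, hT, -, hc⟩
    refine ⟨T, rfl, hT, fun F hF => hc F hF ?_⟩
    classical
    have := SimpleGraph.card_edgeFinset_le_card_choose_two (G := F)
    rw [← Set.ncard_coe_finset, SimpleGraph.coe_edgeFinset, Fintype.card_fin] at this
    refine this.trans ?_
    rw [Nat.choose_two_right]
    simp only [List.length_reverse, List.length_range]
    exact (Nat.div_le_self _ _).trans (Nat.mul_le_mul_left _ (Nat.sub_le _ _))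

end

end Expr

end SteinerRep

namespace SteinerRep

/-! ### Cuts -/

variable {n N : ℕ}

theorem foldl_cons_eq {α β : Type*} (g : α → β) (l : List α) (b : List β) :
    l.foldl (fun acc x => g x :: acc) b = (l.map g).reverse ++ b := by
  induction l generalizing b with
  | nil => rfl
  | cons x l ih => simp [ih]

theorem length_le_of_forall_subset {C : List (Set (Fin n))} {U : Finset (Fin n)} (hC : C.Nodup)
    (h : ∀ A ∈ C, A ⊆ U) : C.length ≤ 2 ^ U.card := by
  classical
  rw [← List.toFinset_card_of_nodup hC, ← Finset.card_powerset]
  refine Finset.card_le_card_of_injOn (fun A => Finset.univ.filter (· ∈ A)) (fun A hA => ?_) ?_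
  · simp only [Finset.coe_powerset, Set.mem_preimage, Set.mem_powerset_iff]
    intro x hx
    exact h A (by simpa using hA) (by simpa using hx)
  · intro A _ B _ hAB
    ext x
    simpa using Finset.ext_iff.1 hAB x

/-- `C` lists the subsets of `Z` without `z₀`. -/
structure ListsCuts (Z : Set (Fin n)) (z₀ : Fin n) (C : List (Set (Fin n))) : Prop where
  nodup : C.Nodup
  mem_iff : ∀ A, A ∈ C ↔ A ⊆ Z ∧ z₀ ∉ A

theorem ListsCuts.length_le {Z : Finset (Fin n)} {z₀ : Fin n} {C : List (Set (Fin n))}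
    (h : ListsCuts (Z : Set (Fin n)) z₀ C) (hz : z₀ ∈ Z) : C.length ≤ 2 ^ (Z.card - 1) := by
  rw [← Finset.card_erase_of_mem hz]
  refine length_le_of_forall_subset h.nodup fun A hA x hx => ?_
  have := (h.mem_iff A).1 hA
  simp only [Finset.coe_erase, Set.mem_sdiff, Set.mem_singleton_iff]
  exact ⟨this.1 hx, fun h => this.2 (h ▸ hx)⟩

/-- The cuts with respect to which `X` is not divided. -/
def cutVec (cut : Fin N → Set (Fin n)) (X : Set (Fin n)) : Set (Fin N) :=
  {i | X ⊆ cut i ∨ ∀ x, x ∈ X → x ∉ cut i}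

/-- A subgraph `H` of recorded cost `k`, with the cuts that do not divide a class of its recorded
partition. -/
structure Elt (n N : ℕ) where
  V : Set (Fin N)
  k : ℕ
  H : SimpleGraph (Fin n)

/-- Encoding of an element. -/
noncomputable def Elt.enc (r : Elt n N) : Val :=
  .pair (encodeSet r.V) (.pair (.num r.k) (encodeAdj r.H))

/-- Encoding of an element together with a working vector. -/
noncomputable def encodeWork (y : Set (Fin N) × Elt n N) : Val := .pair (encodeSet y.1) y.2.enc

/-- The element that joins an entry to an element. -/
def Elt.join (cut : Fin N → Set (Fin n)) (e : Entry n) (r : Elt n N) : Elt n N where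
  V := r.V ∩ cutVec cut e.X
  k := r.k + e.k
  H := r.H ⊔ e.H

/-- The inner product of two sets over the field with two elements. -/
noncomputable def dot (V q : Set (Fin N)) : ZMod 2 := ∑ i, (V ∩ q).indicator 1 i

theorem dot_symmDiff (V V' q : Set (Fin N)) :
    dot {i | ¬(i ∈ V ↔ i ∈ V')} q = dot V q + dot V' q := by
  classical
  unfold dot
  rw [← Finset.sum_add_distrib]
  refine Finset.sum_congr rfl fun i _ => ?_
  have h2 : (1 : ZMod 2) + 1 = 0 := rfl
  simp only [Set.indicator_apply, Set.mem_inter_iff, Set.mem_ofPred_eq]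
  by_cases h1 : i ∈ V <;> by_cases h2 : i ∈ V' <;> by_cases h3 : i ∈ q <;> simp [*]

/-! ### Programs for listing cuts and for Gaussian elimination, and their correctness -/

namespace Expr

/-- The list of the subsets of `z` without its last vertex. -/
def cuts (a z : Expr) : Expr :=
  -- Vertices come in decreasing order. The first one met in `z` becomes `z₀` and starts the list
  -- with `∅`; each later one doubles the list. An empty accumulator signals that `z₀` has not been
  -- met.
  fold a (const 0)
    (ite (mem (lift (lift a)) (lift (lift z)) (var 1))
      (ite (isPair (var 0))
        (fold (var 0) (var 0) (pair (tab (lift (lift (lift (lift a))))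
          (or (eq (var 0) (var 4))
            (mem (lift (lift (lift (lift (lift a))))) (var 2) (var 0)))) (var 0)))
        (pair (tab (lift (lift a)) (const 0)) (const 0)))
      (var 0))

/-- The cuts in `cs` that do not divide `x`. -/
def cutVec (b a cs x : Expr) : Expr :=
  tab b (uncut (lift a) (lift x) (nth (lift b) (lift cs) (var 0)))

/-- The cheapest element of `l` whose working vector contains `j`. -/
def best (b j l : Expr) : Expr :=
  fold l (const 0)
    (ite (and (mem (lift (lift b)) (fst (var 1)) (lift (lift j)))
        (or (not (isPair (var 0))) (le (fst (snd (snd (var 1)))) (fst (snd (snd (var 0)))))))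
      (var 1) (var 0))

/-- Addition of the working vector of `p` to all working vectors in `l` that contain `j`. -/
def eliminate (b j p l : Expr) : Expr :=
  -- When `p` is the pivot chosen from `l`, it is itself altered, and its working vector becomes
  -- empty; no element has to be removed.
  fold l (const 0)
    (pair (ite (mem (lift (lift b)) (fst (var 1)) (lift (lift j)))
      (pair (symmDiff (lift (lift b)) (fst (var 1)) (fst (lift (lift p)))) (snd (var 1)))
      (var 1)) (var 0))

/-- Selection of a cheapest basis by Gaussian elimination. -/
def reduce (b l : Expr) : Expr :=
  fst (fold b (pair (const 0) l)
    (letIn (best (lift (lift b)) (var 1) (snd (var 0)))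
      (ite (isPair (var 0))
        (pair (pair (snd (var 0)) (fst (var 1)))
          (eliminate (lift (lift (lift b))) (var 2) (var 0) (snd (var 1))))
        (var 1))))

section
variable {m : ℕ} {a b c l j p z x : Expr} {ρ : List Val}

theorem Wp.cuts {Z : Finset (Fin n)} (hm : n ≤ m) (hm' : 2 ^ (Z.card - 1) ≤ m)
    (ha : a.Ev m ρ (downto n)) (hz : z.Ev m ρ (encodeSet (Z : Set (Fin n))))
    (hZ : Z.Nonempty) :
    (Expr.cuts a z).Wp m ρ fun v => ∃ (z₀ : Fin n) (C : List (Set (Fin n))), z₀ ∈ Z ∧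
      v = .ofList (C.map encodeSet) ∧ ListsCuts (Z : Set (Fin n)) z₀ C := by
  rw [downto_eq] at ha
  refine Wp.fold (fun pre v => ((∀ x ∈ pre, x ∉ Z) ∧ v = .ofList []) ∨
    ∃ (z₀ : Fin n) (C : List (Set (Fin n))), z₀ ∈ Z ∧ z₀ ∈ pre ∧ v = .ofList (C.map encodeSet) ∧
      ListsCuts {x | x ∈ Z ∧ x ∈ pre} z₀ C) ha Ev.const (by simpa using hm)
    (Or.inl ⟨by simp, rfl⟩) ?_ ?_
  · rintro pre v post hpre acc hacc
    have ha' : a.Ev m ρ (downto n) := by rwa [downto_eq]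
    -- The sets listed so far avoid `v`, so those extended by `v` are new.
    have hv : v ∉ pre := by
      have := (List.nodup_reverse.2 (List.nodup_finRange n))
      rw [hpre, List.nodup_append] at this
      exact fun h => this.2.2 v h v (by simp) rfl
    refine (Ev.mem (X := (Z : Set (Fin n))) (i := v) hm ha'.lift.lift hz.lift.lift
      (Ev.var rfl)).iteWp (fun hvZ => ?_) fun hvZ => ?_
    · rcases hacc with ⟨hno, rfl⟩ | ⟨z₀, C, hz₀, hz₀', rfl, hC⟩
      · refine (Ev.isPair (Ev.var rfl)).iteWp (fun h => absurd h (by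
          simp [Val.ofList, Val.isPair])) fun _ => ?_
        have : (tab (.lift (.lift a)) (.const 0)).Ev m (Val.ofList [] :: .num v :: ρ)
            (encodeSet (∅ : Set (Fin n))) := Ev.tab ha'.lift.lift (fun i => by
              change Ev m _ _ (tv (i ∈ (∅ : Set (Fin n))))
              rw [tv_false (by simp)]
              exact Ev.const) hm
        refine this.pair Ev.const _ (Or.inr ⟨v, [∅], hvZ, by simp, rfl, by simp, fun A => ?_⟩)
        rw [List.mem_singleton]
        constructor
        · rintro rfl
          simp
        · rintro ⟨h1, h2⟩
          refine Set.eq_empty_of_forall_notMem fun x hx => ?_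
          have := h1 hx
          simp only [List.mem_append, List.mem_singleton, Set.mem_ofPred_eq] at this
          rcases this.2 with h | rfl
          · exact hno x h this.1
          · exact h2 hx
      -- The empty cut is always listed, so the test for a pair detects that `z₀` has been met.
      · have hCne : C ≠ [] := List.ne_nil_of_mem ((hC.mem_iff ∅).2 (by simp))
        refine (Ev.isPair (Ev.var rfl)).iteWp (fun _ => ?_) fun h => absurd (by
          obtain ⟨A, C, rfl⟩ := List.exists_cons_of_ne_nil hCne
          rfl) h
        -- Even in the middle of the loop all listed sets lie in `Z` without `z₀`.
        have hlen : C.length ≤ m := by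
          refine le_trans ?_ hm'
          rw [← Finset.card_erase_of_mem hz₀]
          refine length_le_of_forall_subset hC.nodup fun A hA x hx => ?_
          have := (hC.mem_iff A).1 hA
          simp only [Finset.coe_erase, Set.mem_sdiff, Set.mem_singleton_iff]
          exact ⟨(this.1 hx).1, fun h => this.2 (h ▸ hx)⟩
        have key := Ev.fold (m := m) (l := .var 0) (i := .var 0) (enc := encodeSet (n := n))
          (ρ := Val.ofList (C.map encodeSet) :: .num v :: ρ) (xs := C)
          (enc' := fun D : List (Set (Fin n)) => .ofList (D.map encodeSet)) (b₀ := C)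
          (b := pair (tab (lift (lift (lift (lift a))))
          (or (eq (var 0) (var 4))
            (mem (lift (lift (lift (lift (lift a))))) (var 2) (var 0)))) (var 0))
          (fun D A => {x | (x : ℕ) = v ∨ x ∈ A} :: D) (Ev.var rfl) (Ev.var rfl) hlen
          (fun A _ D => Ev.pair (Ev.tab ha'.lift.lift.lift.lift (fun i =>
            (Ev.eq (Ev.var rfl) (Ev.var rfl)).or fun _ =>
              Ev.mem hm ha'.lift.lift.lift.lift.lift (Ev.var rfl) (Ev.var rfl)) hm) (Ev.var rfl))
        refine key _ (Or.inr ⟨z₀, _, hz₀, by simp [hz₀'], rfl, ?_, ?_⟩)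
        · rw [foldl_cons_eq]
          have hvA : ∀ A ∈ C, v ∉ A := fun A hA hvA => hv (((hC.mem_iff A).1 hA).1 hvA).2
          refine List.Nodup.append (List.nodup_reverse.2 (hC.nodup.map_on ?_)) hC.nodup ?_
          · intro A hA B hB hAB
            ext x
            have := Set.ext_iff.1 hAB x
            simp only [← Fin.ext_iff, Set.mem_ofPred_eq] at this
            by_cases hx : x = v
            · subst hx; simp [hvA A hA, hvA B hB]
            · simpa [hx] using this
          · intro A hA hA'
            rw [List.mem_reverse, List.mem_map] at hA
            obtain ⟨B, -, rfl⟩ := hA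
            exact hvA _ hA' (Or.inl rfl)
        · intro A
          rw [foldl_cons_eq, List.mem_append, List.mem_reverse, List.mem_map, hC.mem_iff]
          have hne : z₀ ≠ v := fun h => hv (h ▸ hz₀')
          constructor
          · rintro (⟨B, hB, rfl⟩ | ⟨h1, h2⟩)
            · rw [hC.mem_iff] at hB
              refine ⟨?_, ?_⟩
              · rintro x (hx | hx)
                · rw [Fin.ext hx]
                  exact ⟨hvZ, by simp⟩
                · exact ⟨(hB.1 hx).1, by simp [(hB.1 hx).2]⟩
              · rintro (h | h)
                · exact hne (Fin.ext h)
                · exact hB.2 h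
            · exact ⟨fun x hx => ⟨(h1 hx).1, by simp [(h1 hx).2]⟩, h2⟩
          · rintro ⟨h1, h2⟩
            have h3 : ∀ x ∈ A, x ≠ v → x ∈ Z ∧ x ∈ pre := fun x hx hxv => by
              have := h1 hx
              simpa [hxv] using this
            by_cases hvA : v ∈ A
            · refine Or.inl ⟨A \ {v}, (hC.mem_iff _).2 ⟨fun x hx => h3 x hx.1 hx.2,
                fun h => h2 h.1⟩, ?_⟩
              ext x
              simp only [← Fin.ext_iff, Set.mem_ofPred_eq, Set.mem_sdiff, Set.mem_singleton_iff]
              by_cases hx : x = v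
              · simp [hx, hvA]
              · simp [hx]
            · exact Or.inr ⟨fun x hx => h3 x hx fun h => hvA (h ▸ hx), h2⟩
    · refine (Ev.var rfl) _ ?_
      rcases hacc with ⟨hno, rfl⟩ | ⟨z₀, C, hz₀, hz₀', rfl, hC⟩
      · refine Or.inl ⟨fun x hx => ?_, rfl⟩
        rcases List.mem_append.1 hx with hx | hx
        · exact hno x hx
        · rw [List.mem_singleton.1 hx]; exact hvZ
      · refine Or.inr ⟨z₀, C, hz₀, by simp [hz₀'], rfl, ?_⟩
        have : {x | x ∈ Z ∧ x ∈ pre ++ [v]} = {x | x ∈ Z ∧ x ∈ pre} := by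
          ext x
          simp only [List.mem_append, List.mem_singleton, Set.mem_ofPred_eq]
          constructor
          · rintro ⟨h1, h2 | rfl⟩
            · exact ⟨h1, h2⟩
            · exact absurd h1 hvZ
          · exact fun h => ⟨h.1, Or.inl h.2⟩
        rwa [this]
  · rintro v (⟨hno, -⟩ | ⟨z₀, C, hz₀, -, rfl, hC⟩)
    · obtain ⟨x, hx⟩ := hZ
      exact absurd hx (hno x (by simp))
    · refine ⟨z₀, C, hz₀, rfl, ?_⟩
      have : {x | x ∈ Z ∧ x ∈ (List.finRange n).reverse} = (Z : Set (Fin n)) := by ext; simp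
      rwa [this] at hC

theorem Ev.cutVec {X : Set (Fin n)} {cut : Fin N → Set (Fin n)} (hm : n ≤ m) (hN : N ≤ m)
    (hb : b.Ev m ρ (downto N)) (ha : a.Ev m ρ (downto n))
    (hc : c.Ev m ρ (table fun i => encodeSet (cut i))) (hx : x.Ev m ρ (encodeSet X)) :
    (Expr.cutVec b a c x).Ev m ρ (encodeSet (SteinerRep.cutVec cut X)) :=
  Ev.tab hb (fun _ => Ev.uncut hm ha.lift hx.lift
    (Ev.nth (f := fun i => encodeSet (cut i)) hb.lift hc.lift (Ev.var rfl) hN)) hN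

theorem Wp.best {W : List (Set (Fin N) × Elt n N)} {i : Fin N} (hN : N ≤ m) (hW : W.length ≤ m)
    (hb : b.Ev m ρ (downto N)) (hj : j.Ev m ρ (.num i))
    (hl : l.Ev m ρ (.ofList (W.map encodeWork))) :
    (Expr.best b j l).Wp m ρ fun v => (v = .num 0 ∧ ∀ y ∈ W, i ∉ y.1) ∨
      ∃ p ∈ W, v = encodeWork p ∧ i ∈ p.1 ∧ ∀ y ∈ W, i ∈ y.1 → p.2.k ≤ y.2.k := by
  refine Wp.fold (fun pre v => (v = .num 0 ∧ ∀ y ∈ pre, i ∉ y.1) ∨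
      ∃ p ∈ pre, v = encodeWork p ∧ i ∈ p.1 ∧ ∀ y ∈ pre, i ∈ y.1 → p.2.k ≤ y.2.k) hl Ev.const hW
    (Or.inl ⟨rfl, by simp⟩) ?_ fun v hv => hv
  rintro pre x post - acc hacc
  have hmem : ∀ acc, (mem (.lift (.lift b)) (.fst (.var 1)) (.lift (.lift j))).Ev m
      (acc :: encodeWork x :: ρ) (tv (i ∈ x.1)) := fun acc =>
    Ev.mem hN hb.lift.lift (Ev.fst (Ev.var rfl)) hj.lift.lift
  rcases hacc with ⟨rfl, hno⟩ | ⟨p, hp, rfl, hip, hmin⟩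
  -- While nothing has been chosen, the disjunction holds by its first part, and the cost of the
  -- number `0` is never read.
  · refine (Ev.and (q := True) (hmem _) fun _ => ?_).iteWp (fun h => ?_) fun h => ?_
    · rw [show (True : Prop) = (¬((Val.num 0).isPair = true) ∨ True) by simp]
      exact (Ev.isPair (Ev.var rfl)).not.or fun h => absurd (by simp [Val.isPair]) h
    · refine (Ev.var rfl) _ (Or.inr ⟨x, by simp, rfl, h.1, fun y hy hiy => ?_⟩)
      rcases List.mem_append.1 hy with hy | hy
      · exact absurd hiy (hno y hy)
      · rw [List.mem_singleton.1 hy]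
    · refine (Ev.var rfl) _ (Or.inl ⟨rfl, fun y hy => ?_⟩)
      rcases List.mem_append.1 hy with hy | hy
      · exact hno y hy
      · rw [List.mem_singleton.1 hy]
        exact fun h' => h ⟨h', trivial⟩
  · refine (Ev.and (q := x.2.k ≤ p.2.k) (hmem _) fun _ => ?_).iteWp (fun h => ?_) fun h => ?_
    · rw [show (x.2.k ≤ p.2.k) = (¬((encodeWork p).isPair = true) ∨ x.2.k ≤ p.2.k) by
        simp [encodeWork, Val.isPair]]
      exact (Ev.isPair (Ev.var rfl)).not.or fun h => Ev.le
        (Ev.fst (Ev.snd (Ev.snd (Ev.var rfl)))) (Ev.fst (Ev.snd (Ev.snd (Ev.var rfl))))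
    · refine (Ev.var rfl) _ (Or.inr ⟨x, by simp, rfl, h.1, fun y hy hiy => ?_⟩)
      rcases List.mem_append.1 hy with hy | hy
      · exact h.2.trans (hmin y hy hiy)
      · rw [List.mem_singleton.1 hy]
    · refine (Ev.var rfl) _ (Or.inr ⟨p, by simp [hp], rfl, hip, fun y hy hiy => ?_⟩)
      rcases List.mem_append.1 hy with hy | hy
      · exact hmin y hy hiy
      · rw [List.mem_singleton.1 hy] at hiy ⊢
        exact (not_le.1 fun h' => h ⟨hiy, h'⟩).le

open Classical in
theorem Ev.eliminate {W : List (Set (Fin N) × Elt n N)} {q : Set (Fin N) × Elt n N} {i : Fin N}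
    (hN : N ≤ m) (hW : W.length ≤ m) (hb : b.Ev m ρ (downto N)) (hj : j.Ev m ρ (.num i))
    (hp : p.Ev m ρ (encodeWork q)) (hl : l.Ev m ρ (.ofList (W.map encodeWork))) :
    (Expr.eliminate b j p l).Ev m ρ (.ofList ((W.map fun y =>
      if i ∈ y.1 then ({x | ¬(x ∈ y.1 ↔ x ∈ q.1)}, y.2) else y).reverse.map encodeWork)) := by
  have := Ev.fold (enc' := fun W : List (Set (Fin N) × Elt n N) => .ofList (W.map encodeWork))
    (b₀ := []) (b := .pair (.ite (.mem (.lift (.lift b)) (.fst (.var 1)) (.lift (.lift j)))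
      (.pair (.symmDiff (.lift (.lift b)) (.fst (.var 1)) (.fst (.lift (.lift p))))
        (.snd (.var 1))) (.var 1)) (.var 0)) (fun W y =>
      (if i ∈ y.1 then ({x | ¬(x ∈ y.1 ↔ x ∈ q.1)}, y.2) else y) :: W) hl Ev.const hW
    (fun y _ acc => by
      refine Ev.pair ?_ (Ev.var rfl)
      have h1 := Ev.mem (X := y.1) hN hb.lift.lift
        (Ev.fst (Ev.var (i := 1) (ρ := .ofList (acc.map encodeWork) :: encodeWork y :: ρ) rfl))
        hj.lift.lift
      by_cases h : i ∈ y.1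
      · refine h1.iteTrue h ?_
        rw [if_pos h]
        exact (Ev.symmDiff hN hb.lift.lift (Ev.fst (Ev.var rfl)) (Ev.fst hp.lift.lift)).pair
          (Ev.snd (Ev.var rfl))
      · refine h1.iteFalse h ?_
        rw [if_neg h]
        exact Ev.var rfl)
  rwa [foldl_cons_eq, List.append_nil] at this

/-- For a test vector `q` and a budget `k`, either a chosen element within the budget has product
`1` with `q`, or every working vector within the budget still has the same product with `q` as its
original vector. A cheapest pivot preserves this: it alters only elements that cost no less, and a
pivot with product `0` changes no product. In the end all working vectors are empty, so an original
product `1` forces the first alternative. -/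
theorem Wp.reduce {W : List (Set (Fin N) × Elt n N)} (hN : N ≤ m) (hW : W.length ≤ m)
    (hb : b.Ev m ρ (downto N)) (hl : l.Ev m ρ (.ofList (W.map encodeWork)))
    (hW' : ∀ y ∈ W, y.1 = y.2.V) :
    (Expr.reduce b l).Wp m ρ fun v => ∃ R : List (Elt n N), v = .ofList (R.map Elt.enc) ∧
      R.length ≤ N ∧ (∀ r ∈ R, ∃ y ∈ W, y.2 = r) ∧
      ∀ (q : Set (Fin N)) (k : ℕ), ∀ y ∈ W, y.2.k ≤ k → dot y.2.V q = 1 →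
        ∃ r ∈ R, r.k ≤ k ∧ dot r.V q = 1 := by
  classical
  rw [downto_eq] at hb
  refine Wp.fold (fun pre v => ∃ (R : List (Elt n N)) (L : List (Set (Fin N) × Elt n N)),
    v = .pair (.ofList (R.map Elt.enc)) (.ofList (L.map encodeWork)) ∧ R.length ≤ pre.length ∧
    (∀ r ∈ R, ∃ y ∈ W, y.2 = r) ∧ L.length = W.length ∧ (∀ z ∈ L, ∃ y ∈ W, y.2 = z.2) ∧
    (∀ y ∈ W, ∃ z ∈ L, y.2 = z.2) ∧ (∀ z ∈ L, ∀ i ∈ pre, i ∉ z.1) ∧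
    ∀ (q : Set (Fin N)) (k : ℕ), (∃ r ∈ R, r.k ≤ k ∧ dot r.V q = 1) ∨
      ∀ z ∈ L, z.2.k ≤ k → dot z.1 q = dot z.2.V q) hb (Ev.pair Ev.const hl) (by simpa using hN)
    ⟨[], W, rfl, le_rfl, by simp, rfl, fun z hz => ⟨z, hz, rfl⟩, fun z hz => ⟨z, hz, rfl⟩,
      by simp, fun q k => Or.inr fun z hz _ => by rw [hW' z hz]⟩ ?_ ?_
  · rintro pre i post - acc ⟨R, L, rfl, hRl, hR, hLl, hL, hL', hz, hq⟩
    have hb' : b.Ev m ρ (downto N) := by rwa [downto_eq]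
    refine (Wp.best (n := n) (W := L) (i := i) hN (hLl ▸ hW) hb'.lift.lift (Ev.var rfl)
      (Ev.snd (Ev.var rfl))).mono ?_
    rintro v (⟨rfl, hno⟩ | ⟨p, hp, rfl, hip, hmin⟩)
    · refine (Ev.isPair (Ev.var rfl)).iteWp (fun h => absurd h (by simp [Val.isPair]))
        fun _ => (Ev.var rfl) _ ⟨R, L, rfl, by simp; omega, hR, hLl, hL, hL', fun z hzL => ?_, hq⟩
      intro i' hi'
      rcases List.mem_append.1 hi' with h | h
      · exact hz z hzL i' h
      · rw [List.mem_singleton.1 h]; exact hno z hzL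
    · refine (Ev.isPair (Ev.var rfl)).iteWp (fun _ => ?_) fun h => absurd rfl h
      refine Ev.pair (Ev.pair (Ev.snd (Ev.var rfl)) (Ev.fst (Ev.var rfl)))
        (Ev.eliminate (n := n) (W := L) (q := p) (i := i) hN (hLl ▸ hW) hb'.lift.lift.lift
          (Ev.var rfl) (Ev.var rfl) (Ev.snd (Ev.var rfl))) _
        ⟨p.2 :: R, _, rfl, by simp; omega, ?_, by simpa using hLl, ?_, ?_, ?_, ?_⟩
      · intro r hr
        rcases List.mem_cons.1 hr with rfl | hr
        · exact hL p hp
        · exact hR r hr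
      · intro z hzL
        simp only [List.mem_reverse, List.mem_map] at hzL
        obtain ⟨y, hy, rfl⟩ := hzL
        obtain ⟨y', hy', h⟩ := hL y hy
        exact ⟨y', hy', by rw [h]; split_ifs <;> rfl⟩
      · intro y hy
        obtain ⟨z, hzL, h⟩ := hL' y hy
        refine ⟨_, List.mem_reverse.2 (List.mem_map_of_mem hzL), ?_⟩
        rw [h]; split_ifs <;> rfl
      · intro z hzL i' hi'
        simp only [List.mem_reverse, List.mem_map] at hzL
        obtain ⟨y, hy, rfl⟩ := hzL
        rcases List.mem_append.1 hi' with h | h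
        · have h1 := hz y hy i' h
          have h2 := hz p hp i' h
          split_ifs
          · simp [h1, h2]
          · exact h1
        · rw [List.mem_singleton.1 h]
          split_ifs with hiy
          · simp [hiy, hip]
          · exact hiy
      · intro q k
        rcases hq q k with ⟨r, hr, h⟩ | hq
        · exact Or.inl ⟨r, List.mem_cons_of_mem _ hr, h⟩
        by_cases hpq : p.2.k ≤ k ∧ dot p.2.V q = 1
        · exact Or.inl ⟨p.2, by simp, hpq⟩
        refine Or.inr fun z hzL hzk => ?_
        simp only [List.mem_reverse, List.mem_map] at hzL
        obtain ⟨y, hy, rfl⟩ := hzL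
        split_ifs at hzk ⊢ with hiy
        -- Minimality of the pivot puts it within the budget of every element it alters.
        · have hpk : p.2.k ≤ k := (hmin y hy hiy).trans hzk
          have h0 : dot p.1 q = 0 := by
            rw [hq p hp hpk]
            have : dot p.2.V q ≠ 1 := fun h => hpq ⟨hpk, h⟩
            revert this
            generalize dot p.2.V q = d
            revert d
            decide
          simp only [dot_symmDiff, h0, add_zero]
          exact hq y hy hzk
        · exact hq y hy hzk
  · rintro v ⟨R, L, rfl, hRl, hR, hLl, hL, hL', hz, hq⟩
    refine ⟨R, rfl, by simpa using hRl, hR, fun q k y hy hyk hyq => ?_⟩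
    rcases hq q k with h | h
    · exact h
    obtain ⟨z, hzL, hyz⟩ := hL' y hy
    rw [hyz] at hyk hyq
    rw [← h z hzL hyk, show z.1 = ∅ from Set.eq_empty_of_forall_notMem fun i =>
      hz z hzL i (by simp)] at hyq
    simp [dot] at hyq

end

end Expr

end SteinerRep

namespace SteinerRep

/-! ### Partitions and cuts -/

variable {n N : ℕ}

/-- The cuts that do not divide a class of `P`. -/
def cutsOf {Z : Finset (Fin n)} (cut : Fin N → Set (Fin n)) (P : Setoid {x // x ∈ Z}) :
    Set (Fin N) :=
  {i | P ≤ Setoid.ker fun x => x.1 ∈ cut i}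

/-- The partition into the set `X` and singletons. -/
def block (Z : Finset (Fin n)) (X : Set (Fin n)) : Setoid {x // x ∈ Z} where
  r a b := a = b ∨ a.1 ∈ X ∧ b.1 ∈ X
  iseqv :=
    { refl := fun _ => Or.inl rfl
      symm := by
        rintro a b (rfl | ⟨h, h'⟩)
        exacts [Or.inl rfl, Or.inr ⟨h', h⟩]
      trans := by
        rintro a b c (rfl | ⟨h, h'⟩) (rfl | ⟨k, k'⟩)
        exacts [Or.inl rfl, Or.inr ⟨k, k'⟩, Or.inr ⟨h, h'⟩, Or.inr ⟨h, k'⟩] }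

/-- Joins become intersections because `⊔` is a least upper bound. This is what factors the
connectivity matrix through the cuts. -/
theorem cutsOf_sup {Z : Finset (Fin n)} (cut : Fin N → Set (Fin n)) (P Q : Setoid {x // x ∈ Z}) :
    cutsOf cut (P ⊔ Q) = cutsOf cut P ∩ cutsOf cut Q := by
  ext i
  simp only [cutsOf, Set.mem_inter_iff, Set.mem_ofPred_eq, sup_le_iff]

theorem cutsOf_block {Z : Finset (Fin n)} (cut : Fin N → Set (Fin n)) {X : Set (Fin n)}
    (hX : X ⊆ Z) : cutsOf cut (block Z X) = cutVec cut X := by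
  ext i
  constructor
  · intro h
    by_cases hx : ∃ x ∈ X, x ∈ cut i
    · obtain ⟨x, hx, hxi⟩ := hx
      exact Or.inl fun y hy => ((h (x := ⟨x, hX hx⟩) (y := ⟨y, hX hy⟩) (Or.inr ⟨hx, hy⟩)).to_iff).1 hxi
    · push Not at hx
      exact Or.inr hx
  · rintro (h | h) x y (rfl | ⟨hx, hy⟩)
    · rfl
    · exact propext (iff_of_true (h hx) (h hy))
    · rfl
    · exact propext (iff_of_false (h _ hx) (h _ hy))

open Classical in
/-- The number of cuts that do not divide a class is odd exactly for the trivial partition. -/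
theorem sum_cuts_eq {Z : Finset (Fin n)} {z₀ : Fin n} (hz : z₀ ∈ Z) (P : Setoid {x // x ∈ Z}) :
    ∑ A : Set (Fin n) with A ⊆ (Z : Set (Fin n)) ∧ z₀ ∉ A,
      (if P ≤ Setoid.ker (fun x => x.1 ∈ A) then (1 : ZMod 2) else 0) = if P = ⊤ then 1 else 0 := by
  split_ifs with hP
  · subst hP
    -- The one-class partition is respected only by the empty cut, since cuts avoid `z₀`.
    rw [Finset.sum_eq_single ∅]
    · exact if_pos fun x y _ => rfl
    · intro A hA hA0
      rw [if_neg]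
      intro h
      obtain ⟨x, hx⟩ := Set.nonempty_iff_ne_empty.2 hA0
      obtain ⟨hAZ, hzA⟩ := (Finset.mem_filter.1 hA).2
      have : (x ∈ A) = (z₀ ∈ A) := h (x := ⟨x, hAZ hx⟩) (y := ⟨z₀, hz⟩) trivial
      exact hzA (this ▸ hx)
    · intro h
      simp at h
  · have hx : ∃ x, ¬P x ⟨z₀, hz⟩ := by
      by_contra! h
      exact hP (eq_top_iff.2 fun x y _ => P.trans (h x) (P.symm (h y)))
    obtain ⟨x, hx⟩ := hx
    -- `B` is a class without `z₀`. Symmetric difference with `B` is an involution without fixed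
    -- points on the cuts, and it preserves being respected by `P`, so the sum cancels in pairs.
    set B : Set (Fin n) := {y | ∃ h : y ∈ Z, P x ⟨y, h⟩} with hB
    have hPB : ∀ u v : {x // x ∈ Z}, P u v → (u.1 ∈ B ↔ v.1 ∈ B) := fun u v huv =>
      ⟨fun ⟨_, h⟩ => ⟨v.2, P.trans h huv⟩, fun ⟨_, h⟩ => ⟨u.2, P.trans h (P.symm huv)⟩⟩
    have hinv : ∀ A : Set (Fin n), symmDiff (symmDiff A B) B = A := fun A => symmDiff_symmDiff_cancel_right _ _
    have hle : ∀ A : Set (Fin n), P ≤ Setoid.ker (fun x => x.1 ∈ A) →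
        P ≤ Setoid.ker (fun x => x.1 ∈ symmDiff A B) := by
      intro A h u v huv
      have h1 : (u.1 ∈ A) = (v.1 ∈ A) := h huv
      have h2 := hPB u v huv
      show (u.1 ∈ symmDiff A B) = (v.1 ∈ symmDiff A B)
      rw [Set.mem_symmDiff, Set.mem_symmDiff, h1, h2]
    refine Finset.sum_involution (fun A _ => symmDiff A B) ?_ ?_ ?_ ?_
    · intro A _
      have : (P ≤ Setoid.ker fun x => x.1 ∈ symmDiff A B) ↔ P ≤ Setoid.ker fun x => x.1 ∈ A :=
        ⟨fun h => by simpa only [hinv] using hle _ h, hle A⟩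
      simp only [this]
      split_ifs <;> decide
    · intro A _ _ h
      have : B = ⊥ := symmDiff_eq_left.1 h
      have hxB : x.1 ∈ B := ⟨x.2, P.refl x⟩
      rw [this] at hxB
      exact hxB
    · intro A hA
      obtain ⟨hAZ, hzA⟩ := (Finset.mem_filter.1 hA).2
      refine Finset.mem_filter.2 ⟨Finset.mem_univ _, ?_, ?_⟩
      · rintro y (⟨hy, -⟩ | ⟨⟨hy, -⟩, -⟩)
        exacts [hAZ hy, hy]
      · rintro (⟨hy, -⟩ | ⟨⟨_, hy⟩, -⟩)
        exacts [hzA hy, hx hy]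
    · intro A _
      exact hinv A

/-- The inner product counts, modulo two, the cuts that respect both `P` and `Q`, and these are the
cuts that respect `P ⊔ Q`. -/
theorem dot_cutsOf_eq_one_iff {Z : Finset (Fin n)} {z₀ : Fin n} {C : List (Set (Fin n))}
    (hz : z₀ ∈ Z) (hC : ListsCuts (Z : Set (Fin n)) z₀ C) (P Q : Setoid {x // x ∈ Z}) :
    dot (cutsOf C.get P) (cutsOf C.get Q) = 1 ↔ P ⊔ Q = ⊤ := by
  classical
  have h : dot (cutsOf C.get P) (cutsOf C.get Q) = if P ⊔ Q = ⊤ then 1 else 0 := by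
    rw [← sum_cuts_eq hz, dot, ← cutsOf_sup]
    have hset : (Finset.univ.filter fun A : Set (Fin n) => A ⊆ (Z : Set (Fin n)) ∧ z₀ ∉ A) = C.toFinset := by
      ext A
      simp [hC.mem_iff]
    rw [hset, List.sum_toFinset _ hC.nodup, ← List.sum_ofFn]
    have : C.map (fun A => if P ⊔ Q ≤ Setoid.ker (fun x : {x // x ∈ Z} => x.1 ∈ A)
        then (1 : ZMod 2) else 0) = List.ofFn fun i => if P ⊔ Q ≤ Setoid.ker
          (fun x : {x // x ∈ Z} => x.1 ∈ C.get i) then (1 : ZMod 2) else 0 := by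
      conv_lhs => rw [← List.ofFn_get C, List.map_ofFn]
      rfl
    rw [this]
    congr 2
  rw [h]
  split_ifs with hPQ <;> simp [hPQ]

/-! ### Families of subgraphs -/

/-- The partition of `Z` by the connected components of `H`. -/
def compPartition (H : SimpleGraph (Fin n)) (Z : Finset (Fin n)) : Setoid {x // x ∈ Z} :=
  H.reachableSetoid.comap Subtype.val

theorem compPartition_mono {H H' : SimpleGraph (Fin n)} (h : H ≤ H') (Z : Finset (Fin n)) :
    compPartition H Z ≤ compPartition H' Z :=
  fun _ _ hxy => SimpleGraph.Reachable.mono h hxy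

/-- The properties of the elements that the algorithm generates. -/
structure Elt.Valid (G : SimpleGraph (Fin n)) (w : Sym2 (Fin n) → ℕ) (S : Set (Fin n))
    (Z : Finset (Fin n)) (cut : Fin N → Set (Fin n)) (r : Elt n N) : Prop where
  within : Within G S r.H
  cost_le : graphCost w r.H ≤ r.k
  -- The inequality can be strict: a union of graphs may connect vertices of `Z` through shared
  -- vertices outside `Z`, which the join of the recorded partitions misses.
  exists_partition : ∃ P ≤ compPartition r.H Z, r.V = cutsOf cut P

theorem Elt.Valid.join {G : SimpleGraph (Fin n)} {w : Sym2 (Fin n) → ℕ} {S : Set (Fin n)}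
    {Z : Finset (Fin n)} {cut : Fin N → Set (Fin n)} {r : Elt n N} {e : Entry n}
    (hr : r.Valid G w S Z cut) (he : e.Valid G w S Z) : (r.join cut e).Valid G w S Z cut where
  within := hr.within.sup he.within
  cost_le := (graphCost_sup_le w _ _).trans (add_le_add hr.cost_le he.cost_le)
  exists_partition := by
    obtain ⟨P, hP, hV⟩ := hr.exists_partition
    refine ⟨P ⊔ block Z e.X, sup_le (hP.trans (compPartition_mono le_sup_left Z)) ?_, ?_⟩
    · refine le_trans ?_ (compPartition_mono le_sup_right Z)
      rintro x y (rfl | ⟨hx, hy⟩)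
      · exact Setoid.refl' _ _
      · exact (he.reach _ hx).symm.trans (he.reach _ hy)
    · rw [cutsOf_sup, cutsOf_block cut he.subset, ← hV]
      rfl

/-- The partition that is generated by the sets of the entries. -/
def joinOf (Z : Finset (Fin n)) (σ : List (Entry n)) : Setoid {x // x ∈ Z} :=
  ⨆ e ∈ σ, block Z e.X

/-- A graph inside `S` is a union of entries of the table that do not cost more. -/
theorem exists_sublist {G : SimpleGraph (Fin n)} {w : Sym2 (Fin n) → ℕ} {S : Set (Fin n)}
    {Z : Finset (Fin n)} {T : List (Entry n)} (hT : ValidTable G w S Z T)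
    {F : SimpleGraph (Fin n)} (hF : ∀ v, Dominates T (Entry.ofGraph w Z F v)) :
    ∃ σ : List (Entry n), σ.Sublist T ∧ compPartition F Z ≤ joinOf Z σ ∧
      (σ.map Entry.k).sum ≤ graphCost w F := by
  classical
  -- The least vertex of `Z` in its component represents it, so each component that meets `Z` is
  -- used only once.
  let rep : Fin n → Prop := fun v => v ∈ Z ∧ ∀ u ∈ Z, F.Reachable v u → v ≤ u
  let good : Entry n → Prop := fun e => rep e.v ∧ e.key = (Entry.ofGraph w Z F e.v).key ∧
    e.k ≤ (Entry.ofGraph w Z F e.v).k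
  refine ⟨T.filter (good ·), List.filter_sublist, fun x y hxy => ?_, ?_⟩
  · obtain ⟨v, hv, hmin⟩ := Finset.exists_min_image (Z.filter fun u => F.Reachable x u) id
      ⟨x.1, by simp⟩
    rw [Finset.mem_filter] at hv
    obtain ⟨e, heT, hek, hec⟩ := hF v
    have hev : e.v = v := (Prod.ext_iff.1 hek).2
    have heX : e.X = {x | x ∈ (Z : Set (Fin n)) ∧ F.Reachable v x} := (Prod.ext_iff.1 hek).1
    have hg : e ∈ T.filter (good ·) := by
      rw [List.mem_filter]
      refine ⟨heT, decide_eq_true ⟨⟨hev ▸ hv.1, fun u hu hr => ?_⟩, hev ▸ hek, hev ▸ hec⟩⟩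
      rw [hev] at hr ⊢
      exact hmin u (Finset.mem_filter.2 ⟨hu, hv.2.trans hr⟩)
    have hle : block Z e.X ≤ joinOf Z (T.filter (good ·)) :=
      le_iSup₂ (f := fun (e : Entry n) (_ : e ∈ T.filter (good ·)) => block Z e.X) e hg
    refine hle (Or.inr ?_)
    rw [heX]
    exact ⟨⟨x.2, hv.2.symm⟩, y.2, hv.2.symm.trans hxy⟩
  · set σ := T.filter (good ·) with hσ
    have hgood : ∀ e ∈ σ, good e := fun e he => by simpa using (List.mem_filter.1 he).2
    have hnd : (σ.map Entry.v).Nodup := by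
      have h1 : σ.Nodup := (List.filter_sublist).nodup (hT.nodup.of_map _)
      refine h1.map_on fun e he f hf hef => ?_
      refine List.inj_on_of_nodup_map hT.nodup (List.mem_filter.1 he).1 (List.mem_filter.1 hf).1 ?_
      rw [(hgood e he).2.1, (hgood f hf).2.1, hef]
    calc (σ.map Entry.k).sum ≤ (σ.map fun e => (Entry.ofGraph w Z F e.v).k).sum :=
          List.sum_le_sum fun e he => (hgood e he).2.2
      _ = ∑ v ∈ (σ.map Entry.v).toFinset, (Entry.ofGraph w Z F v).k := by
          rw [List.sum_toFinset _ hnd, List.map_map]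
          rfl
      _ = ∑ v ∈ (σ.map Entry.v).toFinset, ∑ e, (reachEdges F v).indicator w e := rfl
      _ = ∑ e, ∑ v ∈ (σ.map Entry.v).toFinset, (reachEdges F v).indicator w e :=
          Finset.sum_comm
      _ ≤ ∑ e, F.edgeSet.indicator w e := by
          -- An edge belongs to the component of at most one representative, so it is paid for at
          -- most once.
          refine Finset.sum_le_sum fun e _ => ?_
          have hrep : ∀ v ∈ (σ.map Entry.v).toFinset, rep v := by
            intro v hv
            obtain ⟨f, hf, rfl⟩ := List.mem_map.1 (List.mem_toFinset.1 hv)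
            exact (hgood f hf).1
          by_cases h : ∃ v ∈ (σ.map Entry.v).toFinset, e ∈ reachEdges F v
          · obtain ⟨v, hv, hev⟩ := h
            rw [Finset.sum_eq_single_of_mem v hv, Set.indicator_of_mem hev,
              Set.indicator_of_mem hev.1]
            intro u hu huv
            refine Set.indicator_of_notMem (fun heu => huv ?_) _
            obtain ⟨he, x, hx, hvx⟩ := hev
            obtain ⟨-, y, hy, huy⟩ := heu
            have hxy : F.Reachable x y := by
              by_cases hxy : x = y
              · rw [hxy]
              · rw [((Sym2.mem_and_mem_iff hxy).1 ⟨hx, hy⟩), SimpleGraph.mem_edgeSet] at he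
                exact he.reachable
            have hr := (hvx.trans hxy).trans huy.symm
            exact le_antisymm ((hrep u hu).2 v (hrep v hv).1 hr.symm)
              ((hrep v hv).2 u (hrep u hu).1 hr)
          · push Not at h
            rw [Finset.sum_eq_zero fun v hv => Set.indicator_of_notMem (h v hv) _]
            exact Nat.zero_le _

/-! ### The representative family and the complete algorithm -/

namespace Expr

/-- The elements of `rs`, and their joins with the entry `e`, with their working vectors. -/
def candidates (b a cs rs e : Expr) : Expr :=
  fold rs (const 0) (pair (pair (fst (var 1)) (var 1)) (pair
    (letIn (pair (inter (lift (lift b)) (fst (var 1))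
        (cutVec (lift (lift b)) (lift (lift a)) (lift (lift cs)) (entX (lift (lift e)))))
      (pair (add (fst (snd (var 1))) (entK (lift (lift e))))
        (graphUnion (lift (lift a)) (snd (snd (var 1))) (entH (lift (lift e))))))
      (pair (fst (var 0)) (var 0)))
    (var 0)))

/-- The representative family that is generated by the table `t`. -/
def family (b a cs t : Expr) : Expr :=
  -- The start is the edgeless graph at cost `0`. No cut divides a singleton, so its vector is full.
  fold t (pair (pair (tab b (const 1)) (pair (const 0) (emptyGraph a))) (const 0))
    (reduce (lift (lift b))
      (candidates (lift (lift b)) (lift (lift a)) (lift (lift cs)) (var 0) (var 1)))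

/-- The output for a family `rs` of subgraphs with the vertex set `s`. -/
def output (s rs : Expr) : Expr :=
  fold rs (const 0) (pair (pair (lift (lift s)) (snd (snd (var 1)))) (var 0))

/-- The algorithm. -/
def main : Expr :=
  -- From variable `0` on, the scope of the last line holds the family, the indices of the cuts, the
  -- cuts, the table, the set `Z ∪ Y`, the indices of the vertices, and the input.
  letIn (range (snd (snd (var 0))))
  (letIn (union (var 0) (snd (snd (var 1))) (fst (snd (var 1))))
  (letIn (entries (var 1) (fst (var 2)) (var 0) (snd (snd (var 2))))
  (letIn (cuts (var 2) (snd (snd (var 3))))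
  (letIn (range (var 0))
  (letIn (family (var 0) (var 4) (var 1) (var 2))
  (output (var 4) (var 0)))))))

section
variable {m : ℕ} {a b c e t l s : Expr} {ρ : List Val} {x : Entry n}

theorem Ev.candidates {R : List (Elt n N)} {cut : Fin N → Set (Fin n)} (hm : n ≤ m) (hN : N ≤ m)
    (hR : R.length ≤ m) (hb : b.Ev m ρ (downto N)) (ha : a.Ev m ρ (downto n))
    (hc : c.Ev m ρ (table fun i => encodeSet (cut i)))
    (hl : l.Ev m ρ (.ofList (R.map Elt.enc))) (he : e.Ev m ρ x.enc) :
    (Expr.candidates b a c l e).Ev m ρ (.ofList ((R.foldl (fun W r =>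
      (r.V, r) :: ((r.join cut x).V, r.join cut x) :: W) []).map encodeWork)) := by
  unfold Expr.candidates
  refine Ev.fold (enc' := fun W : List (Set (Fin N) × Elt n N) => .ofList (W.map encodeWork))
    (b₀ := []) (fun W r => (r.V, r) :: ((r.join cut x).V, r.join cut x) :: W) hl Ev.const hR ?_
  intro r _ W
  have hj := ((Ev.inter hN hb.lift.lift (Ev.fst (Ev.var (i := 1) rfl))
    (Ev.cutVec hm hN hb.lift.lift ha.lift.lift hc.lift.lift he.lift.lift.entX)).pair
    (((Ev.fst (Ev.snd (Ev.var (i := 1) rfl))).add he.lift.lift.entK).pair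
      (Ev.graphUnion hm ha.lift.lift (Ev.snd (Ev.snd (Ev.var (i := 1)
        (ρ := .ofList (W.map encodeWork) :: r.enc :: ρ) rfl))) he.lift.lift.entH)))
  exact ((Ev.fst (Ev.var rfl)).pair (Ev.var rfl)).pair
    ((Ev.letIn (u := (r.join cut x).enc) hj ((Ev.fst (Ev.var rfl)).pair (Ev.var rfl))).pair
      (Ev.var rfl))

/-- The invariant compares the family with all sublists of the part of the table processed so far. A
sublist that uses the new entry `x` is tested against `Q` as the rest of it is tested against `block
Z x.X ⊔ Q`, so the old family supplies an element whose join with `x` succeeds. Reduction then keeps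
one at least as good. -/
theorem Wp.family {G : SimpleGraph (Fin n)} {w : Sym2 (Fin n) → ℕ} {S : Set (Fin n)}
    {Z : Finset (Fin n)} {z₀ : Fin n} {C : List (Set (Fin n))} {T : List (Entry n)}
    (hm : n ≤ m) (hZ : 2 ^ Z.card ≤ m) (hTm : T.length ≤ m) (hz : z₀ ∈ Z)
    (hC : ListsCuts (Z : Set (Fin n)) z₀ C) (hT : ValidTable G w S Z T)
    (hb : b.Ev m ρ (downto C.length)) (ha : a.Ev m ρ (downto n))
    (hc : c.Ev m ρ (.ofList (C.map encodeSet))) (ht : t.Ev m ρ (encodeEntries T)) :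
    (Expr.family b a c t).Wp m ρ fun v => ∃ R : List (Elt n C.length),
      v = .ofList (R.map Elt.enc) ∧ R.length ≤ C.length ∧ (∀ r ∈ R, r.Valid G w S Z C.get) ∧
      ∀ σ : List (Entry n), σ.Sublist T → ∀ Q : Setoid {x // x ∈ Z}, joinOf Z σ ⊔ Q = ⊤ →
        ∃ r ∈ R, r.k ≤ (σ.map Entry.k).sum ∧ dot r.V (cutsOf C.get Q) = 1 := by
  -- The candidates are twice as many as the elements of a reduced family, and still at most `2 ^
  -- Z.card`.
  have hcard : 2 * 2 ^ (Z.card - 1) = 2 ^ Z.card := by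
    rw [← pow_succ', Nat.sub_add_cancel (Finset.card_pos.2 ⟨z₀, hz⟩)]
  have hCl := hC.length_le hz
  have hCm : C.length ≤ m := by omega
  have hc' : c.Ev m ρ (table fun i => encodeSet (C.get i)) := by
    have : C.map encodeSet = List.ofFn fun i => encodeSet (C.get i) := by
      conv_lhs => rw [← List.ofFn_get C, List.map_ofFn]
      rfl
    rwa [this] at hc
  have hi : (Expr.pair (pair (tab b (const 1)) (pair (const 0) (emptyGraph a))) (const 0)).Ev m ρ
      (.ofList ([(⟨Set.univ, 0, ⊥⟩ : Elt n C.length)].map Elt.enc)) :=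
    ((Ev.tab (g := fun i => tv (i ∈ Set.univ)) hb (fun i => by
      rw [tv_true (Set.mem_univ i)]; exact Ev.const) hCm).pair
      (Ev.const.pair (Ev.emptyGraph hm ha))).pair Ev.const
  have huniv : (Set.univ : Set (Fin C.length)) = cutsOf C.get (⊥ : Setoid {x // x ∈ Z}) :=
    by
    ext i
    simp [cutsOf]
  refine Wp.fold (fun pre v => ∃ R : List (Elt n C.length),
      v = .ofList (R.map Elt.enc) ∧ R.length ≤ C.length ∧ (∀ r ∈ R, r.Valid G w S Z C.get) ∧
      ∀ σ : List (Entry n), σ.Sublist pre → ∀ Q : Setoid {x // x ∈ Z}, joinOf Z σ ⊔ Q = ⊤ →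
        ∃ r ∈ R, r.k ≤ (σ.map Entry.k).sum ∧ dot r.V (cutsOf C.get Q) = 1) ht hi hTm
    ⟨_, rfl, List.length_pos_of_mem ((hC.mem_iff ∅).2 (by simp)), ?_, ?_⟩ ?_ fun v hv => hv
  · intro r hr
    rw [List.mem_singleton.1 hr]
    exact ⟨Within.bot, by simp, ⊥, bot_le, huniv⟩
  · intro σ hσ Q hQ
    obtain rfl := List.sublist_nil.1 hσ
    refine ⟨_, List.mem_singleton_self _, le_rfl, ?_⟩
    rw [huniv, dot_cutsOf_eq_one_iff hz hC]
    simpa [joinOf] using hQ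
  · rintro pre x post hpre acc ⟨R, rfl, hRl, hR, hq⟩
    have hx := hT.valid x (by simp [hpre])
    have hcand := Ev.candidates (m := m) (b := lift (lift b)) (a := lift (lift a))
      (c := lift (lift c)) (l := var 0) (e := var 1) (ρ := .ofList (R.map Elt.enc) :: x.enc :: ρ)
      hm hCm (hRl.trans hCm) hb.lift.lift ha.lift.lift hc'.lift.lift (Ev.var rfl) (Ev.var rfl)
    have hfold : ∀ (R : List (Elt n C.length)) (W : List (Set (Fin C.length) × Elt n C.length)),
        (∀ y, y ∈ R.foldl (fun W r => (r.V, r) :: ((r.join C.get x).V, r.join C.get x) :: W) W ↔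
          y ∈ W ∨ ∃ r ∈ R, y = (r.V, r) ∨ y = ((r.join C.get x).V, r.join C.get x)) ∧
        (R.foldl (fun W r => (r.V, r) :: ((r.join C.get x).V, r.join C.get x) :: W) W).length =
          W.length + 2 * R.length := by
      intro R
      induction R with
      | nil => simp
      | cons r R ih =>
        intro W
        refine ⟨fun y => ?_, ?_⟩
        · rw [List.foldl_cons, (ih _).1]
          simp only [List.mem_cons, exists_eq_or_imp]
          simp only [or_assoc, or_left_comm]
        · rw [List.foldl_cons, (ih _).2]
          simp only [List.length_cons]
          ring
    obtain ⟨hmem, hlen⟩ := hfold R []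
    set W := R.foldl (fun W r => (r.V, r) :: ((r.join C.get x).V, r.join C.get x) :: W) []
    simp only [List.not_mem_nil, false_or] at hmem
    refine (Wp.reduce hCm (by rw [hlen, List.length_nil]; omega) hb.lift.lift hcand ?_).mono ?_
    · intro y hy
      obtain ⟨r, -, rfl | rfl⟩ := (hmem y).1 hy <;> rfl
    · rintro v ⟨R', rfl, hRl', hR', hq'⟩
      refine ⟨R', rfl, hRl', fun r hr => ?_, fun σ hσ Q hQ => ?_⟩
      · obtain ⟨y, hy, rfl⟩ := hR' r hr
        obtain ⟨r', hr', rfl | rfl⟩ := (hmem y).1 hy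
        · exact hR r' hr'
        · exact (hR r' hr').join hx
      · obtain ⟨σ₁, σ₂, rfl, h1, h2⟩ := List.sublist_append_iff.1 hσ
        rcases List.sublist_singleton.1 h2 with rfl | rfl
        · rw [List.append_nil] at hQ ⊢
          obtain ⟨r, hr, hrk, hrd⟩ := hq σ₁ h1 Q hQ
          exact hq' _ _ (r.V, r) ((hmem _).2 ⟨r, hr, Or.inl rfl⟩) hrk hrd
        · have hQ' : joinOf Z σ₁ ⊔ (block Z x.X ⊔ Q) = ⊤ := by
            rw [← hQ, ← sup_assoc]
            congr 1
            simp [joinOf, iSup_or, iSup_sup_eq]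
          obtain ⟨r, hr, hrk, hrd⟩ := hq σ₁ h1 _ hQ'
          refine hq' _ _ ((r.join C.get x).V, r.join C.get x) ((hmem _).2 ⟨r, hr, Or.inr rfl⟩)
            (by simpa [Elt.join] using hrk) ?_
          obtain ⟨P, -, hV⟩ := (hR r hr).exists_partition
          rw [hV, dot_cutsOf_eq_one_iff hz hC] at hrd
          change dot (r.V ∩ SteinerRep.cutVec C.get x.X) _ = 1
          rw [hV, ← cutsOf_block C.get hx.subset, ← cutsOf_sup, dot_cutsOf_eq_one_iff hz hC, ← hrd,
            sup_assoc]

theorem Ev.output {R : List (Elt n N)} {S : Set (Fin n)} (hR : R.length ≤ m)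
    (hs : s.Ev m ρ (encodeSet S)) (hl : l.Ev m ρ (.ofList (R.map Elt.enc))) :
    (Expr.output s l).Ev m ρ
      (.ofList ((R.map fun r => Val.pair (encodeSet S) (encodeAdj r.H)).reverse)) := by
  have := Ev.fold (enc' := Val.ofList) (b₀ := [])
    (b := .pair (.pair (.lift (.lift s)) (.snd (.snd (.var 1)))) (.var 0))
    (fun acc r => Val.pair (encodeSet S) (encodeAdj r.H) :: acc) hl Ev.const hR fun r _ acc =>
    (hs.lift.lift.pair (Ev.snd (Ev.snd (Ev.var rfl)))).pair (Ev.var rfl)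
  rwa [foldl_cons_eq, List.append_nil] at this

end

end Expr

/-! ### The main theorem -/

/-- The subgraph of `G` with the vertex set `S` and the edges of `H`. -/
def subgraphOf (G : SimpleGraph (Fin n)) (S : Set (Fin n)) (H : SimpleGraph (Fin n)) :
    G.Subgraph where
  verts := S
  Adj x y := H.Adj x y ∧ G.Adj x y ∧ x ∈ S ∧ y ∈ S
  adj_sub h := h.2.1
  edge_vert h := h.2.2.1
  symm := ⟨fun _ _ h => ⟨h.1.symm, h.2.1.symm, h.2.2.2, h.2.2.1⟩⟩

theorem subgraphOf_adj {G : SimpleGraph (Fin n)} {S : Set (Fin n)} {H : SimpleGraph (Fin n)}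
    (h : Within G S H) (x y : Fin n) : (subgraphOf G S H).Adj x y ↔ H.Adj x y :=
  ⟨fun hxy => hxy.1, fun hxy => ⟨hxy, h x y hxy⟩⟩

theorem spanningCoe_subgraphOf {G : SimpleGraph (Fin n)} {S : Set (Fin n)}
    {H : SimpleGraph (Fin n)} (h : Within G S H) : (subgraphOf G S H).spanningCoe = H := by
  ext x y
  exact subgraphOf_adj h x y

theorem subgraphOf_mem {G : SimpleGraph (Fin n)} {S : Set (Fin n)} {H : SimpleGraph (Fin n)} :
    subgraphOf G S H ∈ subgraphsOn G S :=
  ⟨fun _ h => h, fun _ _ h => ⟨h.2.2.1, h.2.2.2, h.2.1⟩⟩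

theorem encodeSubgraph_subgraphOf {G : SimpleGraph (Fin n)} {S : Set (Fin n)}
    {H : SimpleGraph (Fin n)} (h : Within G S H) :
    encodeSubgraph (subgraphOf G S H) = .pair (encodeSet S) (encodeAdj H) := by
  unfold encodeSubgraph
  refine congrArg₂ Val.pair rfl (congrArg Val.ofList (congrArg List.ofFn (funext fun i =>
    congrArg Val.ofList (congrArg List.ofFn (funext fun j => congrArg Val.ofBool ?_)))))
  exact decide_eq_decide.2 (subgraphOf_adj h i j)

theorem cost_eq (w : Sym2 (Fin n) → ℕ) {G : SimpleGraph (Fin n)} (F : G.Subgraph) :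
    cost w F = graphCost w F.spanningCoe := by
  classical
  unfold cost graphCost
  rw [Finset.sum_filter]
  refine Finset.sum_congr rfl fun e _ => ?_
  have h : e ∈ F.spanningCoe.edgeSet ↔ e ∈ F.edgeSet := Iff.rfl
  rw [Set.indicator_apply]
  simp only [h]

theorem within_spanningCoe {G : SimpleGraph (Fin n)} {S : Set (Fin n)} {F : G.Subgraph}
    (h : F ∈ subgraphsOn G S) : Within G S F.spanningCoe := fun _ _ hxy =>
  ⟨F.adj_sub hxy, (h.2 hxy).1, (h.2 hxy).2.1⟩

/-- One inequality between the minima is free because `R ⊆ B`; the other follows if each member of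
`B` has a replacement in `R` for each `Q`. -/
theorem represents_of_forall {G : SimpleGraph (Fin n)} {w : Sym2 (Fin n) → ℕ} {Z : Finset (Fin n)}
    {R B : Set G.Subgraph} (hsub : R ⊆ B)
    (h : ∀ Q : Setoid {x // x ∈ Z}, ∀ F ∈ B, connPartition F Z ⊔ Q = ⊤ →
      ∃ F' ∈ R, connPartition F' Z ⊔ Q = ⊤ ∧ cost w F' ≤ cost w F) : Represents w Z R B := by
  intro Q
  refine le_antisymm ?_ ?_
  · exact le_iInf₂ fun F hF => iInf₂_le_of_le F ⟨hsub hF.1, hF.2⟩ le_rfl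
  · refine le_iInf₂ fun F hF => ?_
    obtain ⟨F', hF', hQ, hc⟩ := h Q F hF.1 hF.2
    exact iInf₂_le_of_le F' ⟨hF', hQ⟩ (by exact_mod_cast hc)

namespace Expr

theorem Wp.main {m : ℕ} (G : SimpleGraph (Fin n)) (w : Sym2 (Fin n) → ℕ) (Y Z : Finset (Fin n))
    (hZ : Z.Nonempty) (hm : n * 2 ^ Z.card ≤ m) :
    Expr.main.Wp m [encodeInput G w Y Z] fun v => ∃ R : List G.Subgraph, v = encodeFamily R ∧
      (∀ F ∈ R, F ∈ subgraphsOn G ((Z : Set (Fin n)) ∪ (Y : Set (Fin n)))) ∧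
      R.length ≤ 2 ^ (Z.card - 1) ∧
      Represents w Z {F | F ∈ R} (subgraphsOn G ((Z : Set (Fin n)) ∪ (Y : Set (Fin n)))) := by
  have hpow : 1 ≤ 2 ^ Z.card := Nat.one_le_two_pow
  have hn : 1 ≤ n := by
    obtain ⟨z, -⟩ := hZ
    exact z.pos
  have hnm : n ≤ m := le_trans (Nat.le_mul_of_pos_right n hpow) hm
  have hpm : 2 ^ Z.card ≤ m := le_trans (Nat.le_mul_of_pos_left _ hn) hm
  have hpm' : 2 ^ (Z.card - 1) ≤ m :=
    (Nat.pow_le_pow_right (by norm_num) (Nat.sub_le _ _)).trans hpm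
  have hrange : (range (snd (snd (var 0)))).Ev m [encodeInput G w Y Z] (downto n) := by
    have := Ev.range (m := m) (l := snd (snd (var 0))) (ρ := [encodeInput G w Y Z])
      (xs := List.finRange n) (enc := fun i => tv (i ∈ (Z : Set (Fin n))))
      (Ev.snd (Ev.snd (Ev.var (by
        rw [← List.ofFn_eq_map]
        rfl)))) (by simpa using hnm)
    simpa using this
  refine hrange _ ?_
  refine Ev.union (X := (Z : Set (Fin n))) (X' := (Y : Set (Fin n))) hnm (Ev.var rfl)
    (Ev.snd (Ev.snd (Ev.var rfl))) (Ev.fst (Ev.snd (Ev.var rfl))) _ ?_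
  set S : Set (Fin n) := (Z : Set (Fin n)) ∪ (Y : Set (Fin n)) with hS
  refine (Wp.entries (Z := Z) (S := S) (G := G) (w := w) hnm hm (Ev.var rfl) (Ev.fst (Ev.var rfl))
    (Ev.var rfl) (Ev.snd (Ev.snd (Ev.var rfl)))).mono ?_
  rintro _ ⟨T, rfl, hT, hF⟩
  refine (Wp.cuts (Z := Z) hnm hpm' (Ev.var rfl) (Ev.snd (Ev.snd (Ev.var rfl))) hZ).mono ?_
  rintro _ ⟨z₀, C, hz, rfl, hC⟩
  have hCl := hC.length_le hz
  refine Ev.range (xs := C) (enc := encodeSet) (Ev.var rfl) (hCl.trans hpm') _ ?_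
  refine (Wp.family hnm hpm (hT.length_le.trans hm) hz hC hT (Ev.var rfl) (Ev.var rfl)
    (Ev.var rfl) (Ev.var rfl)).mono ?_
  rintro _ ⟨R, rfl, hRl, hR, hq⟩
  refine Ev.output (S := S) (R := R) (hRl.trans (hCl.trans hpm')) (Ev.var rfl) (Ev.var rfl) _ ?_
  refine ⟨(R.map fun r => subgraphOf G S r.H).reverse, ?_, ?_, ?_, represents_of_forall ?_ ?_⟩
  · rw [encodeFamily, List.map_reverse, List.map_map]
    congr 2
    exact List.map_congr_left fun r hr => (encodeSubgraph_subgraphOf (hR r hr).within).symm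
  · intro F hF
    obtain ⟨r, -, rfl⟩ := List.mem_map.1 (List.mem_reverse.1 hF)
    exact subgraphOf_mem
  · simpa using hRl.trans hCl
  · intro F hF
    obtain ⟨r, -, rfl⟩ := List.mem_map.1 (List.mem_reverse.1 hF)
    exact subgraphOf_mem
  · intro Q F hFS hQ
    obtain ⟨σ, hσ, hP, hcost⟩ := exists_sublist hT (hF _ (within_spanningCoe hFS))
    -- The blocks of `σ` join to something at least as coarse as the partition of `F`, so `Q`
    -- completes them to `⊤` as well.
    obtain ⟨r, hr, hrk, hrd⟩ := hq σ hσ Q (top_le_iff.1 (hQ ▸ sup_le_sup_right hP Q))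
    obtain ⟨P, hPr, hV⟩ := (hR r hr).exists_partition
    rw [hV, dot_cutsOf_eq_one_iff hz hC] at hrd
    refine ⟨subgraphOf G S r.H, List.mem_reverse.2 (List.mem_map_of_mem hr), ?_, ?_⟩
    · rw [connPartition, spanningCoe_subgraphOf (hR r hr).within]
      -- The true partition is coarser than the recorded one, so it also joins with `Q` to `⊤`.
      exact top_le_iff.1 (hrd ▸ sup_le_sup_right hPr Q)
    · rw [cost_eq, cost_eq, spanningCoe_subgraphOf (hR r hr).within]
      exact (hR r hr).cost_le.trans (hrk.trans hcost)

end Expr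

end SteinerRep

theorem mainTheorem4 :
    ∃ (prog : SteinerRep.Prog) (c : ℕ) (p : Polynomial ℕ),
      ∀ (n : ℕ) (G : SimpleGraph (Fin n)) (w : Sym2 (Fin n) → ℕ) (Y Z : Finset (Fin n)),
        Disjoint Y Z → Z.Nonempty →
        ∃ (R : List G.Subgraph) (t : ℕ),
          SteinerRep.Run [SteinerRep.encodeInput G w Y Z] prog (SteinerRep.encodeFamily R) t ∧
          t ≤ 2 ^ (c * Z.card) * p.eval n ∧
          (∀ F ∈ R, F ∈ SteinerRep.subgraphsOn G ((Z : Set (Fin n)) ∪ (Y : Set (Fin n)))) ∧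
          R.length ≤ 2 ^ (Z.card - 1) ∧
          SteinerRep.Represents w Z {F | F ∈ R}
            (SteinerRep.subgraphsOn G ((Z : Set (Fin n)) ∪ (Y : Set (Fin n)))) := by
  obtain ⟨C, d, hCd⟩ := SteinerRep.Expr.main.exists_bound_le
  -- With `m = n * 2 ^ Z.card`, the bound `C * m ^ d` equals `2 ^ (d * Z.card) * (C * n ^ d)`.
  refine ⟨SteinerRep.Expr.main.compile id, d, Polynomial.C C * Polynomial.X ^ d, ?_⟩
  intro n G w Y Z _ hZ
  obtain ⟨v, t, hrun, ht, R, rfl, hR⟩ :=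
    (SteinerRep.Expr.Wp.main G w Y Z hZ le_rfl).run (σ := id) fun _ => rfl
  refine ⟨R, t, hrun, ht.trans ((hCd _ ?_).trans_eq ?_), hR⟩
  · obtain ⟨z, -⟩ := hZ
    exact Nat.mul_pos z.pos Nat.one_le_two_pow
  · simp only [Polynomial.eval_mul, Polynomial.eval_C, Polynomial.eval_pow, Polynomial.eval_X]
    rw [mul_pow, ← pow_mul, mul_comm Z.card d]
    ring
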